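/- An order-$n$ Latin square is an $n\times n$ matrix over $n$ symbols in which every symbol appears exactly once in every row and exactly once in every column. A transversal of a Latin square $L$ of order $n$ is a set of $n$ entries of $L$, exactly one from every row, exactly one from every column, and exactly one of every symbol. Let $T(n)$ denote the maximum number of transversals in an order-$n$ Latin square. Theorem. There is a sequence $\varepsilon_n\in[0,1]$ with $\varepsilon_n\to 0$ as $n\to\infty$ such that for every $n\ge 0$ $$T(n)\;\ge\;\left((1-\varepsilon_n)\,\frac{n}{e^2}\right)^{n}.$$ Moreover, this bound is asymptotically tight: there is a sequence $\delta_n\ge -1$ with $\delta_n\to 0$ as $n\to\infty$ such that for every $n\ge 0$ $$T(n)\;=\;\left((1+\delta_n)\,\frac{n}{e^2}\right)^{n}.$$ (For $n=0$ both right-hand sides are read as $1$.) -/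

import Mathlib

open Filter Topology

/-- An order-`n` Latin square: an `n × n` matrix over `n` symbols such that every symbol
appears exactly once in every row and exactly once in every column. -/
def IsLatinSquare {n : ℕ} (L : Matrix (Fin n) (Fin n) (Fin n)) : Prop :=
  (∀ i k, ∃! j, L i j = k) ∧ (∀ j k, ∃! i, L i j = k)

/-- A transversal of `L`: a set of `n` entries (recorded by their positions), exactly one from
every row, exactly one from every column, and exactly one of every symbol. -/
def IsTransversal {n : ℕ} (L : Matrix (Fin n) (Fin n) (Fin n))
    (s : Finset (Fin n × Fin n)) : Prop :=
  s.card = n ∧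
  (∀ i, ∃! p, p ∈ s ∧ p.1 = i) ∧
  (∀ j, ∃! p, p ∈ s ∧ p.2 = j) ∧
  (∀ k, ∃! p, p ∈ s ∧ L p.1 p.2 = k)

/-- `T(L)`: the number of transversals of `L`. -/
noncomputable def numTransversals {n : ℕ} (L : Matrix (Fin n) (Fin n) (Fin n)) : ℕ :=
  {s : Finset (Fin n × Fin n) | IsTransversal L s}.ncard

open Classical in
/-- `T(n)`: the maximum of `T(L)` over the (finite, nonempty) set of order-`n` Latin squares `L`. -/
noncomputable def maxTransversals (n : ℕ) : ℕ :=
  (Finset.univ.filter fun L : Matrix (Fin n) (Fin n) (Fin n) => IsLatinSquare L).sup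
    numTransversals

/-! ### Permutations with prescribed values -/

section Perm

variable {B ι : Type*} [Fintype B] [DecidableEq B] [Fintype ι]

/-! The theorem amounts to log T(n) = n log n - 2n + o(n), proved by matching bounds.

Upper bound, by entropy. Fix a Latin square and an ordering of its rows, and reveal a uniformly
random transversal X row by row. The log of the number of transversals is at most the expected sum,
over rows i, of the log of the number of columns still available in row i. Now average over
orderings. Given that q rows are still to come after row i, a column other than X i is available iff
two specific other rows, the one using that column and the one using that symbol, are both among
those q. The mean number of available columns is thus 1 + q(q-1)/(n-2). Jensen and Stirling-type
estimates turn the sum of the logs of these means into n log n - 2n + o(n). See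
`sum_card_available`, `log_card_transversalFun_le` and `sum_log_one_add_le`.

Lower bound, by a random block construction. Let m and w be odd and k = m w. Replace each cell of
the addition table of Z_m by an isotopic copy of the addition table of Z_k, scrambled by
permutations of its rows, columns and symbols. Choose a partial transversal with w cells in each of
the m^2 blocks; the greedy count gives about (k^2)^w / w! choices per block. The choices fit
together into a transversal of order m k when, along each line of blocks, the m scrambled w-sets are
disjoint. Averaging over scramblings gives one square in which at least the expected number of
choices fit, and this number is about (m k / e^2)^(m k). See
`card_partialTransversals_mul_factorial_ge`, `card_scatters_ge` and
`exists_blockSquare_many_transversals`.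

To reach every large order n = m k + s, the block square is prolonged along s disjoint transversals,
and only transversals avoiding them are counted. Each of these extends by a fixed transversal of the
s × s corner (`isLatin_prolong`, `maxTransversals_ge_of_odd`). With m a large constant and s
bounded, the total loss is o(n) in the logarithm as m grows. -/

theorem exists_perm_extending {u v : ι → B} (hu : Function.Injective u)
    (hv : Function.Injective v) : ∃ α : Equiv.Perm B, ∀ i, α (u i) = v i := by
  classical
  obtain ⟨g, hg⟩ := Finset.exists_equiv_extend_of_card_eq (α := B) (β := B)
    (t := Finset.univ) (by simp) (s := Finset.univ.image u)
    (f := fun x => if h : ∃ i, u i = x then v h.choose else x) (by simp) (by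
      intro x hx y hy hxy
      simp only [Finset.coe_image, Finset.coe_univ, Set.image_univ, Set.mem_range] at hx hy
      simp only [hx, hy, dif_pos] at hxy
      have := hv hxy
      rw [← hx.choose_spec, this, hy.choose_spec])
  refine ⟨g.trans (Equiv.subtypeUnivEquiv (by simp)), fun i => ?_⟩
  have h := hg (u i) (by simp)
  have h' : ∃ j, u j = u i := ⟨i, rfl⟩
  simp only [h', dif_pos] at h
  simpa [hu h'.choose_spec] using h

/-- One solution `α₀` exists, and the others are its products with permutations fixing the range of
`u` pointwise. -/
theorem card_perm_extending {u v : ι → B} (hu : Function.Injective u)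
    (hv : Function.Injective v) :
    (Finset.univ.filter fun α : Equiv.Perm B => ∀ i, α (u i) = v i).card =
      (Fintype.card B - Fintype.card ι).factorial := by
  classical
  obtain ⟨α₀, h₀⟩ := exists_perm_extending hu hv
  let p : B → Prop := fun x => x ∉ Set.range u
  have hp : Fintype.card {x // p x} = Fintype.card B - Fintype.card ι := by
    rw [Fintype.card_subtype_compl (fun x => x ∈ Set.range u)]
    congr 1
    exact (Fintype.card_congr (Equiv.ofInjective u hu)).symm
  rw [← hp, ← Fintype.card_perm, ← Fintype.card_subtype]
  refine Fintype.card_congr (Equiv.trans ?_ (Equiv.Perm.subtypeEquivSubtypePerm p).symm)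
  refine Equiv.subtypeEquiv (Equiv.mulLeft α₀⁻¹) fun α => ?_
  simp only [p, not_not, Set.mem_range, forall_exists_index, forall_apply_eq_imp_iff,
    Equiv.coe_mulLeft, Equiv.Perm.mul_apply]
  refine forall_congr' fun i => ?_
  rw [Equiv.Perm.inv_eq_iff_eq, h₀]

theorem card_perm_apply_eq (i q : B) :
    (Finset.univ.filter fun π : Equiv.Perm B => π i = q).card =
      (Fintype.card B - 1).factorial := by
  have := card_perm_extending (B := B) (ι := Fin 1) (u := fun _ => i) (v := fun _ => q)
    (Function.injective_of_subsingleton _) (Function.injective_of_subsingleton _)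
  simpa using this

theorem card_perm_apply_eq_three {i r r' q b b' : B} (h₁ : i ≠ r) (h₂ : i ≠ r') (h₃ : r ≠ r')
    (g₁ : q ≠ b) (g₂ : q ≠ b') (g₃ : b ≠ b') :
    (Finset.univ.filter fun π : Equiv.Perm B => π i = q ∧ π r = b ∧ π r' = b').card =
      (Fintype.card B - 3).factorial := by
  have := card_perm_extending (B := B) (ι := Fin 3) (u := ![i, r, r']) (v := ![q, b, b'])
    (by intro x y; fin_cases x <;> fin_cases y <;> simp [h₁, h₂, h₃, h₁.symm, h₂.symm, h₃.symm])
    (by intro x y; fin_cases x <;> fin_cases y <;> simp [g₁, g₂, g₃, g₁.symm, g₂.symm, g₃.symm])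
  simpa [Fin.forall_fin_succ] using this

end Perm

/-- The rows `r`, `r'` can take any of the `q * (q - 1)` ordered pairs of distinct values below `q`;
each choice prescribes three values of the permutation. -/
theorem card_perm_apply_eq_lt_lt {n : ℕ} {i r r' : Fin n} (h₁ : i ≠ r) (h₂ : i ≠ r')
    (h₃ : r ≠ r') (q : Fin n) :
    (Finset.univ.filter fun π : Equiv.Perm (Fin n) => π i = q ∧ π r < q ∧ π r' < q).card =
      (q * (q - 1)) * (n - 3).factorial := by
  have hmaps : Set.MapsTo (fun π : Equiv.Perm (Fin n) => (π r, π r'))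
      ((Finset.univ.filter fun π : Equiv.Perm (Fin n) => π i = q ∧ π r < q ∧ π r' < q) : Finset _)
      ((Finset.Iio q).offDiag : Finset _) := by
    intro π hπ
    simp only [Finset.coe_filter, Finset.mem_univ, true_and, Set.mem_ofPred_eq] at hπ
    simp [hπ, h₃]
  rw [Finset.card_eq_sum_card_fiberwise hmaps]
  have : ∀ b ∈ (Finset.Iio q).offDiag,
      ((Finset.univ.filter fun π : Equiv.Perm (Fin n) =>
        π i = q ∧ π r < q ∧ π r' < q).filter fun π => (π r, π r') = b).card =
      (n - 3).factorial := by
    rintro ⟨b, b'⟩ hb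
    simp only [Finset.mem_offDiag, Finset.mem_Iio] at hb
    have := card_perm_apply_eq_three h₁ h₂ h₃ hb.1.ne' hb.2.1.ne' hb.2.2
    rw [Fintype.card_fin] at this
    rw [← this, Finset.filter_filter]
    congr 1
    ext π
    simp only [Finset.mem_filter, Finset.mem_univ, true_and, Prod.mk.injEq]
    constructor
    · rintro ⟨⟨h, -, -⟩, h', h''⟩
      exact ⟨h, h', h''⟩
    · rintro ⟨h, rfl, rfl⟩
      exact ⟨⟨h, hb.1, hb.2.1⟩, rfl, rfl⟩
  rw [Finset.sum_congr rfl this, Finset.sum_const, Finset.offDiag_card, smul_eq_mul, Fin.card_Iio,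
    Nat.mul_sub_one]

/-! ### The entropy bound for the number of transversals -/

section Upper

variable {n : ℕ} (L : Matrix (Fin n) (Fin n) (Fin n))

/-- The transversals of `L`, as maps from rows to columns. -/
def transversalFun : Finset (Fin n → Fin n) :=
  Finset.univ.filter fun X => Function.Injective X ∧ Function.Injective fun i => L i (X i)

/-- The columns that remain available in row `i` once the rows placed after `i` by `π`
have been assigned their entries of `X`. -/
def available (π : Equiv.Perm (Fin n)) (X : Fin n → Fin n) (i : Fin n) : Finset (Fin n) :=
  Finset.univ.filter fun j => ∀ r, π i < π r → X r ≠ j ∧ L r (X r) ≠ L i j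

variable {L}

theorem mem_available_self {X : Fin n → Fin n} (hX : X ∈ transversalFun L)
    (π : Equiv.Perm (Fin n)) (i : Fin n) : X i ∈ available L π X i := by
  simp only [transversalFun, Finset.mem_filter, Finset.mem_univ, true_and] at hX
  simp only [available, Finset.mem_filter, Finset.mem_univ, true_and]
  intro r hr
  have : r ≠ i := by rintro rfl; exact lt_irrefl _ hr
  exact ⟨fun h => this (hX.1 h), fun h => this (hX.2 h)⟩

theorem available_card_pos {X : Fin n → Fin n} (hX : X ∈ transversalFun L)
    (π : Equiv.Perm (Fin n)) (i : Fin n) : 0 < (available L π X i).card :=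
  Finset.card_pos.2 ⟨_, mem_available_self hX π i⟩

/-- Induction on the number `t` of rows not yet revealed. Choosing an available column uniformly at
each step assigns each transversal the product as its weight, so these weights form a
subprobability. -/
theorem sum_prod_inv_available_le_one_of_agree (π : Equiv.Perm (Fin n)) (t : ℕ) (ht : t ≤ n)
    (𝒮 : Finset (Fin n → Fin n)) (h𝒮 : 𝒮 ⊆ transversalFun L)
    (hagree : ∀ X ∈ 𝒮, ∀ X' ∈ 𝒮, ∀ r, t ≤ (π r : ℕ) → X r = X' r) :
    ∑ X ∈ 𝒮, ∏ i ∈ Finset.univ.filter (fun i => (π i : ℕ) < t),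
      ((available L π X i).card : ℝ)⁻¹ ≤ 1 := by
  induction t generalizing 𝒮 with
  | zero =>
    have : 𝒮.card ≤ 1 := Finset.card_le_one.2 fun X hX X' hX' =>
      funext fun r => hagree X hX X' hX' r (Nat.zero_le _)
    simpa using this
  | succ t ih =>
    rcases 𝒮.eq_empty_or_nonempty with rfl | ⟨X₀, hX₀⟩
    · simp
    set i₀ : Fin n := π.symm ⟨t, ht⟩ with hi₀
    have hπ : π i₀ = ⟨t, ht⟩ := by simp [hi₀]
    -- Availability in row `i₀` depends only on rows of larger `π`-value, where all members of `𝒮`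
    -- agree.
    have havail : ∀ X ∈ 𝒮, available L π X i₀ = available L π X₀ i₀ := by
      intro X hX
      ext j
      simp only [available, Finset.mem_filter, Finset.mem_univ, true_and]
      refine forall_congr' fun r => forall_congr' fun hr => ?_
      rw [hagree X hX X₀ hX₀ r (by rw [hπ] at hr; exact hr)]
    have hfil : Finset.univ.filter (fun i => (π i : ℕ) < t + 1) =
        insert i₀ (Finset.univ.filter (fun i => (π i : ℕ) < t)) := by
      ext i
      simp only [Finset.mem_filter, Finset.mem_univ, true_and, Finset.mem_insert]
      rw [Nat.lt_succ_iff_lt_or_eq, or_comm, hi₀, Equiv.eq_symm_apply, Fin.ext_iff]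
    have hnot : i₀ ∉ Finset.univ.filter (fun i => (π i : ℕ) < t) := by simp [hπ]
    have hmaps : ∀ X ∈ 𝒮, X i₀ ∈ available L π X₀ i₀ := fun X hX => by
      rw [← havail X hX]
      exact mem_available_self (h𝒮 hX) π i₀
    have hpos : (0 : ℝ) < (available L π X₀ i₀).card :=
      Nat.cast_pos.2 (available_card_pos (h𝒮 hX₀) π i₀)
    rw [← Finset.sum_fiberwise_of_maps_to hmaps]
    calc _ ≤ ∑ j ∈ available L π X₀ i₀, ((available L π X₀ i₀).card : ℝ)⁻¹ := by
          refine Finset.sum_le_sum fun j _ => ?_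
          have hstep := ih (by omega) (𝒮.filter fun X => X i₀ = j)
            ((Finset.filter_subset _ _).trans h𝒮) (by
              intro X hX X' hX' r hr
              simp only [Finset.mem_filter] at hX hX'
              rcases hr.eq_or_lt with h | h
              · have : r = i₀ := by rw [hi₀, Equiv.eq_symm_apply]; exact Fin.ext h.symm
                rw [this, hX.2, hX'.2]
              · exact hagree X hX.1 X' hX'.1 r h)
          calc _ = ∑ X ∈ 𝒮.filter (fun X => X i₀ = j), ((available L π X₀ i₀).card : ℝ)⁻¹ *
                ∏ i ∈ Finset.univ.filter (fun i => (π i : ℕ) < t),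
                  ((available L π X i).card : ℝ)⁻¹ := by
                refine Finset.sum_congr rfl fun X hX => ?_
                rw [hfil, Finset.prod_insert hnot, havail X (Finset.mem_filter.1 hX).1]
            _ ≤ _ := by
                rw [← Finset.mul_sum]
                exact mul_le_of_le_one_right (by positivity) hstep
      _ = 1 := by
          rw [Finset.sum_const, nsmul_eq_mul, mul_inv_cancel₀ hpos.ne']

theorem sum_prod_inv_available_le_one (π : Equiv.Perm (Fin n)) :
    ∑ X ∈ transversalFun L, ∏ i, ((available L π X i).card : ℝ)⁻¹ ≤ 1 := by
  have := sum_prod_inv_available_le_one_of_agree π n le_rfl (transversalFun L) subset_rfl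
    (fun _ _ _ _ r hr => absurd (π r).2 (not_lt.2 hr))
  simpa using this

/-- Chain rule for the entropy of a uniformly random transversal. -/
theorem card_mul_log_card_le (π : Equiv.Perm (Fin n)) :
    ((transversalFun L).card : ℝ) * Real.log (transversalFun L).card ≤
      ∑ X ∈ transversalFun L, ∑ i, Real.log (available L π X i).card := by
  rcases (transversalFun L).eq_empty_or_nonempty with h | h
  · simp [h]
  set T : ℝ := ((transversalFun L).card : ℝ) with hT
  have hTpos : 0 < T := Nat.cast_pos.2 (Finset.card_pos.2 h)
  -- Gibbs' inequality in elementary form: `log x ≤ x - 1` at `x = T * ∏ i, |available|⁻¹`. Summed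
  -- over X, the right side is at most zero by the weight bound.
  have key : ∀ X ∈ transversalFun L, Real.log T - ∑ i, Real.log (available L π X i).card ≤
      T * ∏ i, ((available L π X i).card : ℝ)⁻¹ - 1 := by
    intro X hX
    have hpos : ∀ i, (0 : ℝ) < (available L π X i).card := fun i =>
      Nat.cast_pos.2 (available_card_pos hX π i)
    have h1 : 0 < ∏ i, ((available L π X i).card : ℝ)⁻¹ :=
      Finset.prod_pos fun i _ => inv_pos.2 (hpos i)
    have h2 := Real.log_le_sub_one_of_pos (mul_pos hTpos h1)
    rw [Real.log_mul hTpos.ne' h1.ne', Real.log_prod (fun i _ => (inv_pos.2 (hpos i)).ne')] at h2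
    simpa [Real.log_inv, sub_eq_add_neg] using h2
  have hsum := Finset.sum_le_sum key
  rw [Finset.sum_sub_distrib, Finset.sum_sub_distrib, ← Finset.mul_sum, Finset.sum_const,
    Finset.sum_const, nsmul_eq_mul, nsmul_eq_mul, ← hT, mul_one] at hsum
  have := mul_le_mul_of_nonneg_left (sum_prod_inv_available_le_one (L := L) π) hTpos.le
  linarith

/-- The order of summation is exchanged: for each column, count the permutations that leave it
available. `X i` is always available; any other `j` depends on two further rows. -/
theorem sum_card_available (hL : IsLatinSquare L) {X : Fin n → Fin n}
    (hX : X ∈ transversalFun L) (i q : Fin n) :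
    ∑ π ∈ Finset.univ.filter (fun π : Equiv.Perm (Fin n) => π i = q), (available L π X i).card =
      (n - 1).factorial + (n - 1) * ((q * (q - 1)) * (n - 3).factorial) := by
  simp only [transversalFun, Finset.mem_filter, Finset.mem_univ, true_and] at hX
  obtain ⟨hX₁, hX₂⟩ := hX
  let Y := Equiv.ofBijective X (Finite.injective_iff_bijective.1 hX₁)
  let Z := Equiv.ofBijective _ (Finite.injective_iff_bijective.1 hX₂)
  have hYX : ∀ r, Y r = X r := fun r => rfl
  have hZX : ∀ r, Z r = L r (X r) := fun r => rfl
  -- `Y.symm j` is the row where X uses column `j`, and `Z.symm (L i j)` the row where X uses the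
  -- symbol of cell `(i, j)`.
  have hmem : ∀ (π : Equiv.Perm (Fin n)) j, j ∈ available L π X i ↔
      π (Y.symm j) ≤ π i ∧ π (Z.symm (L i j)) ≤ π i := by
    intro π j
    simp only [available, Finset.mem_filter, Finset.mem_univ, true_and]
    constructor
    · intro h
      constructor
      · by_contra! hlt
        exact (h _ hlt).1 (by rw [← hYX, Equiv.apply_symm_apply])
      · by_contra! hlt
        exact (h _ hlt).2 (by rw [← hZX, Equiv.apply_symm_apply])
    · rintro ⟨h1, h2⟩ r hr
      constructor
      · rintro rfl
        rw [← hYX, Equiv.symm_apply_apply] at h1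
        exact not_lt.2 h1 hr
      · intro h
        rw [← h, ← hZX, Equiv.symm_apply_apply] at h2
        exact not_lt.2 h2 hr
  simp_rw [Finset.card_eq_sum_ones]
  have : ∀ π ∈ Finset.univ.filter (fun π : Equiv.Perm (Fin n) => π i = q),
      ∑ _j ∈ available L π X i, 1 =
        ∑ j, if π (Y.symm j) ≤ π i ∧ π (Z.symm (L i j)) ≤ π i then 1 else 0 := by
    intro π _
    rw [← Finset.sum_filter]
    refine Finset.sum_congr ?_ fun _ _ => rfl
    ext j
    simp [hmem]
  rw [Finset.sum_congr rfl this, Finset.sum_comm]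
  simp_rw [← Finset.sum_filter, ← Finset.card_eq_sum_ones, Finset.filter_filter]
  rw [← Finset.add_sum_erase _ _ (Finset.mem_univ (X i))]
  congr 1
  · have h1 : Y.symm (X i) = i := by rw [← hYX, Equiv.symm_apply_apply]
    have h2 : Z.symm (L i (X i)) = i := by rw [← hZX, Equiv.symm_apply_apply]
    simp only [h1, h2, le_refl, and_self, and_true]
    simpa using card_perm_apply_eq i q
  · rw [Finset.sum_congr rfl (g := fun _ => (q * (q - 1)) * (n - 3).factorial)]
    · simp
    · intro j hj
      have hj : j ≠ X i := (Finset.mem_erase.1 hj).1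
      have h1 : i ≠ Y.symm j := fun h => hj (by rw [h, ← hYX, Equiv.apply_symm_apply])
      have h2 : i ≠ Z.symm (L i j) := fun h => by
        have h' : L i (X i) = L i j := by
          rw [← hZX]
          exact (Equiv.eq_symm_apply Z).1 h
        exact hj ((hL.1 i (L i j)).unique rfl h')
      -- If one row used both the column `j` and the symbol `L i j`, that symbol would occur twice
      -- in column `j`.
      have h3 : Y.symm j ≠ Z.symm (L i j) := fun h => by
        have h' : L (Y.symm j) (X (Y.symm j)) = L i j := by
          rw [← hZX]
          exact (Equiv.eq_symm_apply Z).1 h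
        rw [← hYX, Equiv.apply_symm_apply] at h'
        exact h1 ((hL.2 j (L i j)).unique rfl h')
      rw [← card_perm_apply_eq_lt_lt h1 h2 h3 q]
      congr 1
      ext π
      simp only [Finset.mem_filter, Finset.mem_univ, true_and]
      refine and_congr_right fun hq => ?_
      rw [← hq, lt_iff_le_and_ne, lt_iff_le_and_ne]
      have e1 : π (Y.symm j) ≠ π i := fun h => h1 (π.injective h).symm
      have e2 : π (Z.symm (L i j)) ≠ π i := fun h => h2 (π.injective h).symm
      simp [e1, e2]

/-- Jensen's inequality via the tangent to `log` at `a`. -/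
theorem sum_log_le_card_mul_log {ι : Type*} (s : Finset ι) (f : ι → ℝ) (hf : ∀ i ∈ s, 0 < f i)
    {a : ℝ} (ha : 0 < a) (h : ∑ i ∈ s, f i ≤ s.card * a) :
    ∑ i ∈ s, Real.log (f i) ≤ s.card * Real.log a := by
  have h1 : ∀ i ∈ s, Real.log (f i) ≤ Real.log a + (f i / a - 1) := by
    intro i hi
    have := Real.log_le_sub_one_of_pos (div_pos (hf i hi) ha)
    rw [Real.log_div (hf i hi).ne' ha.ne'] at this
    linarith
  refine (Finset.sum_le_sum h1).trans ?_
  rw [Finset.sum_add_distrib, Finset.sum_sub_distrib, ← Finset.sum_div]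
  simp only [Finset.sum_const, nsmul_eq_mul, mul_one]
  have : (∑ i ∈ s, f i) / a ≤ s.card := by rwa [div_le_iff₀ ha]
  linarith

theorem log_card_transversalFun_le (hL : IsLatinSquare L) (hn : 3 ≤ n)
    (hne : (transversalFun L).Nonempty) :
    Real.log (transversalFun L).card ≤
      ∑ q ∈ Finset.range n, Real.log (1 + (q * (q - 1 : ℝ)) / (n - 2)) := by
  have hn2 : (0 : ℝ) < n - 2 := by
    have : (3 : ℝ) ≤ n := by exact_mod_cast hn
    linarith
  set a : Fin n → ℝ := fun q => 1 + ((q : ℕ) * ((q : ℕ) - 1 : ℝ)) / (n - 2) with ha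
  have hqnn : ∀ q : Fin n, 0 ≤ ((q : ℕ) : ℝ) * (((q : ℕ) : ℝ) - 1) := by
    intro q
    rcases Nat.eq_zero_or_pos (q : ℕ) with h | h
    · simp [h]
    · have : (1 : ℝ) ≤ ((q : ℕ) : ℝ) := by exact_mod_cast h
      exact mul_nonneg (by positivity) (by linarith)
  have hapos : ∀ q, 0 < a q := fun q => by
    have := div_nonneg (hqnn q) hn2.le
    simp only [ha]
    linarith
  have hfac1 : ((n - 1).factorial : ℝ) = (n - 1) * ((n - 2) * (n - 3).factorial) := by
    obtain ⟨m, rfl⟩ := Nat.exists_eq_add_of_le hn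
    have e1 : 3 + m - 1 = m + 2 := by omega
    have e2 : 3 + m - 3 = m := by omega
    rw [e1, e2, Nat.factorial_succ, Nat.factorial_succ]
    push_cast
    ring
  have hrow : ∀ X ∈ transversalFun L, ∀ i q : Fin n,
      ∑ π ∈ Finset.univ.filter (fun π : Equiv.Perm (Fin n) => π i = q),
        Real.log (available L π X i).card ≤ (n - 1).factorial * Real.log (a q) := by
    intro X hX i q
    have hc : (Finset.univ.filter (fun π : Equiv.Perm (Fin n) => π i = q)).card =
        (n - 1).factorial := by simpa using card_perm_apply_eq i q
    have := sum_log_le_card_mul_log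
      (Finset.univ.filter (fun π : Equiv.Perm (Fin n) => π i = q))
      (fun π => ((available L π X i).card : ℝ))
      (fun π _ => Nat.cast_pos.2 (available_card_pos hX π i)) (hapos q) (by
        have h := sum_card_available hL hX i q
        rw [hc, ← Nat.cast_sum, h]
        have hq1 : (((q : ℕ) * ((q : ℕ) - 1) : ℕ) : ℝ) = ((q : ℕ) : ℝ) * (((q : ℕ) : ℝ) - 1) := by
          rcases Nat.eq_zero_or_pos (q : ℕ) with h | h
          · simp [h]
          · rw [Nat.cast_mul, Nat.cast_sub h, Nat.cast_one]
        rw [Nat.cast_add, Nat.cast_mul, Nat.cast_mul, hq1, Nat.cast_sub (by omega), Nat.cast_one,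
          hfac1]
        refine le_of_eq ?_
        simp only [ha]
        field_simp)
    rwa [hc] at this
  have hfac : (0 : ℝ) < (n.factorial : ℝ) := by positivity
  have hT : (0 : ℝ) < (transversalFun L).card := Nat.cast_pos.2 (Finset.card_pos.2 hne)
  have hnf : (n.factorial : ℝ) = n * (n - 1).factorial := by
    rw [← Nat.cast_mul, Nat.mul_factorial_pred (by omega)]
  -- The chain-rule bound is summed over all orderings and regrouped by the position `q = π i`. As
  -- `(n - 1)!` orderings share each position, the factor `n * (n - 1)!` cancels.
  have main : (n.factorial : ℝ) *
      (((transversalFun L).card : ℝ) * Real.log (transversalFun L).card) ≤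
      n.factorial * ((transversalFun L).card * ∑ q, Real.log (a q)) := by
    calc _ = ∑ _π : Equiv.Perm (Fin n),
          (((transversalFun L).card : ℝ) * Real.log (transversalFun L).card) := by
          rw [Finset.sum_const, Finset.card_univ, Fintype.card_perm, Fintype.card_fin, nsmul_eq_mul]
      _ ≤ ∑ π : Equiv.Perm (Fin n),
          ∑ X ∈ transversalFun L, ∑ i, Real.log (available L π X i).card :=
          Finset.sum_le_sum fun π _ => card_mul_log_card_le π
      _ = ∑ X ∈ transversalFun L, ∑ i, ∑ q,
          ∑ π ∈ Finset.univ.filter (fun π : Equiv.Perm (Fin n) => π i = q),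
            Real.log (available L π X i).card := by
          rw [Finset.sum_comm]
          refine Finset.sum_congr rfl fun X _ => ?_
          rw [Finset.sum_comm]
          refine Finset.sum_congr rfl fun i _ => ?_
          exact (Finset.sum_fiberwise_of_maps_to (fun π _ => Finset.mem_univ (π i)) _).symm
      _ ≤ ∑ X ∈ transversalFun L, ∑ _i : Fin n, ∑ q, (n - 1).factorial * Real.log (a q) :=
          Finset.sum_le_sum fun X hX => Finset.sum_le_sum fun i _ =>
            Finset.sum_le_sum fun q _ => hrow X hX i q
      _ = _ := by
          simp only [← Finset.mul_sum, Finset.sum_const, nsmul_eq_mul, Finset.card_univ,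
            Fintype.card_fin]
          rw [hnf]
          ring
  have h1 := le_of_mul_le_mul_left main hfac
  have h2 := le_of_mul_le_mul_left h1 hT
  rw [Finset.sum_range]
  exact h2

end Upper

/-! ### Transversals as sets of cells and as functions -/

theorem existsUnique_mem_of_injOn_of_card_eq {α β : Type*} [Fintype β] {s : Finset α} {f : α → β}
    (hf : Set.InjOn f s) (hs : s.card = Fintype.card β) (b : β) : ∃! p, p ∈ s ∧ f p = b := by
  classical
  have himg : s.image f = Finset.univ :=
    Finset.eq_univ_of_card _ (by rw [Finset.card_image_of_injOn hf, hs])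
  obtain ⟨p, hp, hpb⟩ := Finset.mem_image.1 (himg ▸ Finset.mem_univ b)
  exact ⟨p, ⟨hp, hpb⟩, fun q hq => hf hq.1 hp (hq.2.trans hpb.symm)⟩

theorem numTransversals_le_card_transversalFun {n : ℕ} (L : Matrix (Fin n) (Fin n) (Fin n)) :
    numTransversals L ≤ (transversalFun L).card := by
  classical
  unfold numTransversals
  rw [← Set.ncard_coe_finset]
  choose! f hf using fun (s : Finset (Fin n × Fin n)) (hs : IsTransversal L s) => hs.2.1
  have hmem : ∀ s, IsTransversal L s → ∀ i, (i, (f s i).2) ∈ s := by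
    intro s hs i
    have h := (hf s hs i).1
    have : f s i = (i, (f s i).2) := Prod.ext h.2 rfl
    rw [← this]
    exact h.1
  have hfst : ∀ s, IsTransversal L s → ∀ p ∈ s, (p.1, (f s p.1).2) = p := by
    intro s hs p hp
    exact (hs.2.1 p.1).unique ⟨hmem s hs _, rfl⟩ ⟨hp, rfl⟩
  refine Set.ncard_le_ncard_of_injOn (fun s i => (f s i).2) ?_ ?_ (Finset.finite_toSet _)
  · intro s hs
    replace hs : IsTransversal L s := hs
    simp only [transversalFun, Finset.coe_filter, Finset.mem_univ, true_and]
    refine ⟨fun i i' h => ?_, fun i i' h => ?_⟩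
    · exact congrArg Prod.fst
        ((hs.2.2.1 _).unique ⟨hmem s hs i, rfl⟩ ⟨hmem s hs i', h.symm⟩)
    · exact congrArg Prod.fst
        ((hs.2.2.2 _).unique ⟨hmem s hs i, rfl⟩ ⟨hmem s hs i', h.symm⟩)
  · intro s hs s' hs' h
    replace hs : IsTransversal L s := hs
    replace hs' : IsTransversal L s' := hs'
    have h' : ∀ i, (f s i).2 = (f s' i).2 := congrFun h
    ext p
    constructor
    · intro hp
      rw [← hfst s hs p hp, h']
      exact hmem s' hs' _
    · intro hp
      rw [← hfst s' hs' p hp, ← h']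
      exact hmem s hs _

/-! ### Stirling-type estimates and the value of the entropy sum -/

theorem log_factorial_le (n : ℕ) :
    Real.log n.factorial ≤ n * Real.log n - n + Real.log n + 1 := by
  induction n with
  | zero => simp
  | succ n ih =>
    rcases Nat.eq_zero_or_pos n with rfl | hn
    · simp
    have hn' : (0 : ℝ) < n := by exact_mod_cast hn
    have h1 : Real.log n - Real.log (n + 1) ≤ n / (n + 1) - 1 := by
      rw [← Real.log_div hn'.ne' (by positivity)]
      exact Real.log_le_sub_one_of_pos (by positivity)
    have h2 : (n + 1) * (Real.log n - Real.log (n + 1)) ≤ -1 := by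
      refine (mul_le_mul_of_nonneg_left h1 (by positivity)).trans (le_of_eq ?_)
      field_simp
      ring
    rw [Nat.factorial_succ, Nat.cast_mul, Real.log_mul (by positivity) (by positivity)]
    push_cast
    nlinarith

/-- With `y = 1/√x` this is `1 + y² ≤ exp y`, which follows from the cubic Taylor polynomial since
`y² - 3y + 6 > 0`. The square root makes the errors sum harmonically below. -/
theorem log_one_add_le_log_add_sqrt_inv {x : ℝ} (hx : 0 < x) :
    Real.log (1 + x) ≤ Real.log x + (√x)⁻¹ := by
  have hs : 0 < √x := Real.sqrt_pos.2 hx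
  have h0 : (1 : ℝ) + x = x * (1 + x⁻¹) := by field_simp; ring
  have h1 : 1 + x⁻¹ ≤ Real.exp (√x)⁻¹ := by
    have h4 : ((√x)⁻¹) ^ 2 = x⁻¹ := by rw [inv_pow, Real.sq_sqrt hx.le]
    have h5 := Real.sum_le_exp_of_nonneg (x := (√x)⁻¹) (by positivity) 4
    simp only [Finset.sum_range_succ, Finset.sum_range_zero, Nat.factorial] at h5
    set y := (√x)⁻¹ with hy
    have hy0 : 0 < y := by positivity
    rw [← h4]
    norm_num at h5
    nlinarith [mul_nonneg hy0.le (sq_nonneg (y - 3 / 2)), sq_nonneg (y - 3 / 2)]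
  rw [h0, Real.log_mul hx.ne' (by positivity)]
  have := Real.log_le_log (by positivity) h1
  rw [Real.log_exp] at this
  linarith

theorem sum_range_log_add_one (n : ℕ) :
    ∑ q ∈ Finset.range n, Real.log ((q : ℝ) + 1) = Real.log n.factorial := by
  rw [← Finset.prod_range_add_one_eq_factorial, Nat.cast_prod, Real.log_prod]
  · simp
  · intro i _
    positivity

theorem sum_range_log_add_two (n : ℕ) :
    ∑ q ∈ Finset.range n, Real.log ((q : ℝ) + 2) = Real.log (n + 1).factorial := by
  rw [← sum_range_log_add_one, Finset.sum_range_succ']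
  simp only [Nat.cast_add, Nat.cast_one, add_assoc]
  norm_num

theorem sum_log_one_add_le {n : ℕ} (hn : 3 ≤ n) :
    ∑ q ∈ Finset.range n, Real.log (1 + (q * (q - 1 : ℝ)) / (n - 2)) ≤
      n * Real.log n - 2 * n + (5 + Real.log n + √n * (1 + Real.log n)) := by
  obtain ⟨m, rfl⟩ : ∃ m, n = m + 2 := ⟨n - 2, by omega⟩
  have hm : 1 ≤ m := by omega
  have hm' : (1 : ℝ) ≤ m := by exact_mod_cast hm
  have hm0 : (0 : ℝ) < m := by linarith
  -- The terms `q = 0, 1` are `log 1 = 0`. Peeling them off leaves indices with `q(q-1) > 0`.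
  rw [Finset.sum_range_succ', Finset.sum_range_succ']
  have hterm : ∀ q ∈ Finset.range m,
      Real.log (1 + (((q + 1 + 1 : ℕ) : ℝ) * (((q + 1 + 1 : ℕ) : ℝ) - 1)) / (((m + 2 : ℕ) : ℝ) - 2))
        ≤ Real.log ((q : ℝ) + 2) + Real.log ((q : ℝ) + 1) - Real.log m +
          √m * ((q : ℝ) + 1)⁻¹ := by
    intro q _
    have e : (((q + 1 + 1 : ℕ) : ℝ) * (((q + 1 + 1 : ℕ) : ℝ) - 1)) / (((m + 2 : ℕ) : ℝ) - 2) =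
        (((q : ℝ) + 2) * ((q : ℝ) + 1)) / m := by
      push_cast
      ring
    rw [e]
    have hx : 0 < (((q : ℝ) + 2) * ((q : ℝ) + 1)) / m := by positivity
    refine (log_one_add_le_log_add_sqrt_inv hx).trans ?_
    rw [Real.log_div (by positivity) (by positivity), Real.log_mul (by positivity) (by positivity)]
    refine add_le_add_right ?_ _
    rw [Real.sqrt_div' _ hm0.le, inv_div, div_eq_mul_inv]
    refine mul_le_mul_of_nonneg_left ?_ (Real.sqrt_nonneg _)
    refine inv_anti₀ (by positivity) (Real.le_sqrt_of_sq_le ?_)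
    nlinarith [Nat.cast_nonneg (α := ℝ) q]
  have hsum := Finset.sum_le_sum hterm
  rw [Finset.sum_add_distrib, Finset.sum_sub_distrib, Finset.sum_add_distrib, sum_range_log_add_two,
    sum_range_log_add_one, ← Finset.mul_sum, Finset.sum_const, Finset.card_range,
    nsmul_eq_mul] at hsum
  have hharm : ∑ q ∈ Finset.range m, ((q : ℝ) + 1)⁻¹ ≤ 1 + Real.log m := by
    have := harmonic_le_one_add_log m
    rw [harmonic] at this
    push_cast at this
    exact this
  have hf1 := log_factorial_le (m + 1)
  have hf2 := log_factorial_le m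
  have hl1 : Real.log ((m + 1 : ℕ) : ℝ) ≤ Real.log ((m + 2 : ℕ) : ℝ) :=
    Real.log_le_log (by positivity) (by push_cast; linarith)
  have hl2 : Real.log (m : ℝ) ≤ Real.log ((m + 2 : ℕ) : ℝ) :=
    Real.log_le_log (by positivity) (by push_cast; linarith)
  have hl0 : 0 ≤ Real.log (m : ℝ) := Real.log_nonneg hm'
  have hs : √(m : ℝ) ≤ √((m + 2 : ℕ) : ℝ) := Real.sqrt_le_sqrt (by push_cast; linarith)
  have hmul : √(m : ℝ) * ∑ q ∈ Finset.range m, ((q : ℝ) + 1)⁻¹ ≤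
      √((m + 2 : ℕ) : ℝ) * (1 + Real.log ((m + 2 : ℕ) : ℝ)) :=
    mul_le_mul hs (hharm.trans (by linarith)) (Finset.sum_nonneg fun _ _ => by positivity)
      (by positivity)
  have hmul2 : ((m : ℝ) + 2) * Real.log ((m + 1 : ℕ) : ℝ) ≤
      (m + 2) * Real.log ((m + 2 : ℕ) : ℝ) := mul_le_mul_of_nonneg_left hl1 (by linarith)
  push_cast at hf1 hf2 hl1 hl2 hmul hmul2
  norm_num at hsum ⊢
  linarith

theorem log_numTransversals_le {n : ℕ} (hn : 3 ≤ n) {L : Matrix (Fin n) (Fin n) (Fin n)}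
    (hL : IsLatinSquare L) (h : 0 < numTransversals L) :
    Real.log (numTransversals L) ≤
      n * Real.log n - 2 * n + (5 + Real.log n + √n * (1 + Real.log n)) := by
  have h1 := numTransversals_le_card_transversalFun L
  refine (Real.log_le_log (Nat.cast_pos.2 h) (Nat.cast_le.2 h1)).trans ?_
  exact (log_card_transversalFun_le hL hn (Finset.card_pos.1 (h.trans_le h1))).trans
    (sum_log_one_add_le hn)

theorem log_maxTransversals_le {n : ℕ} (hn : 3 ≤ n) (h : 0 < maxTransversals n) :
    Real.log (maxTransversals n) ≤
      n * Real.log n - 2 * n + (5 + Real.log n + √n * (1 + Real.log n)) := by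
  classical
  have hne : (Finset.univ.filter
      fun L : Matrix (Fin n) (Fin n) (Fin n) => IsLatinSquare L).Nonempty := by
    by_contra hemp
    rw [Finset.not_nonempty_iff_eq_empty] at hemp
    simp [maxTransversals, hemp] at h
  obtain ⟨L, hL, heq⟩ := Finset.exists_mem_eq_sup _ hne numTransversals
  have heq' : maxTransversals n = numTransversals L := by
    rw [← heq]
    unfold maxTransversals
    congr
  rw [heq'] at h ⊢
  exact log_numTransversals_le hn (Finset.mem_filter.1 hL).2 h

/-! ### Latin squares on arbitrary index types and prolongation -/

/-- A Latin square whose rows, columns and symbols are all indexed by the (finite) type `A`. -/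
structure IsLatin {A : Type*} (L : A → A → A) : Prop where
  row : ∀ x, Function.Injective (L x)
  col : ∀ y, Function.Injective fun x => L x y

/-- A set of cells meeting every row, every column and every symbol at most once. -/
structure IsPartialTransversal {A : Type*} (L : A → A → A) (s : Finset (A × A)) : Prop where
  row : Set.InjOn Prod.fst (s : Set (A × A))
  col : Set.InjOn Prod.snd (s : Set (A × A))
  sym : Set.InjOn (fun p : A × A => L p.1 p.2) (s : Set (A × A))

open Classical in
/-- The partial transversals of `L` with `w` cells, none of them in `bad`. -/
noncomputable def partialTransversals {A : Type*} [Fintype A] (L : A → A → A) (bad : Set (A × A))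
    (w : ℕ) : Finset (Finset (A × A)) :=
  Finset.univ.filter fun s => s.card = w ∧ IsPartialTransversal L s ∧ ∀ p ∈ s, p ∉ bad

theorem mem_partialTransversals {A : Type*} [Fintype A] {L : A → A → A} {bad : Set (A × A)}
    {w : ℕ} {s : Finset (A × A)} : s ∈ partialTransversals L bad w ↔
      s.card = w ∧ IsPartialTransversal L s ∧ ∀ p ∈ s, p ∉ bad := by
  simp [partialTransversals]

theorem isLatinSquare_of_isLatin {A : Type*} {n : ℕ} (e : A ≃ Fin n) {L : A → A → A}
    (hL : IsLatin L) : IsLatinSquare (fun i j => e (L (e.symm i) (e.symm j))) := by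
  constructor
  · intro i k
    have h : Function.Injective fun j => e (L (e.symm i) (e.symm j)) :=
      e.injective.comp ((hL.row _).comp e.symm.injective)
    exact (Finite.injective_iff_bijective.1 h).existsUnique k
  · intro j k
    have h : Function.Injective fun i => e (L (e.symm i) (e.symm j)) :=
      e.injective.comp ((hL.col _).comp e.symm.injective)
    exact (Finite.injective_iff_bijective.1 h).existsUnique k

/-- A partial transversal with as many cells as the order is a transversal, so any Latin square on a
type of size `n` witnesses a lower bound. -/
theorem card_partialTransversals_le_maxTransversals {A : Type*} [Fintype A] {L : A → A → A}
    (hL : IsLatin L) {n : ℕ} (hn : Fintype.card A = n) :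
    (partialTransversals L ∅ n).card ≤ maxTransversals n := by
  classical
  obtain ⟨e⟩ : Nonempty (A ≃ Fin n) := ⟨Fintype.equivFinOfCardEq hn⟩
  set M : Matrix (Fin n) (Fin n) (Fin n) := fun i j => e (L (e.symm i) (e.symm j)) with hM
  have h1 : numTransversals M ≤ maxTransversals n := by
    unfold maxTransversals
    exact Finset.le_sup (f := numTransversals) (by simpa using isLatinSquare_of_isLatin e hL)
  refine le_trans ?_ h1
  unfold numTransversals
  rw [← Set.ncard_coe_finset]
  refine Set.ncard_le_ncard_of_injOn (fun s => s.map (e.prodCongr e).toEmbedding) ?_ ?_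
    (Set.toFinite _)
  · intro s hs
    obtain ⟨hc, hs, -⟩ := mem_partialTransversals.1 (Finset.mem_coe.1 hs)
    have hc' : (s.map (e.prodCongr e).toEmbedding).card = Fintype.card (Fin n) := by simp [hc]
    have key : ∀ (f : A × A → A), Set.InjOn f s → ∀ g : Fin n × Fin n → Fin n,
        (∀ p, g ((e.prodCongr e) p) = e (f p)) →
        Set.InjOn g (s.map (e.prodCongr e).toEmbedding : Finset _) := by
      intro f hf g hg p hp q hq hpq
      simp only [Finset.coe_map, Set.mem_image, Finset.mem_coe, Equiv.coe_toEmbedding] at hp hq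
      obtain ⟨p', hp', rfl⟩ := hp
      obtain ⟨q', hq', rfl⟩ := hq
      rw [hg, hg] at hpq
      rw [hf hp' hq' (e.injective hpq)]
    refine ⟨by simp [hc], ?_, ?_, ?_⟩
    · exact existsUnique_mem_of_injOn_of_card_eq (key Prod.fst hs.row Prod.fst (by simp)) hc'
    · exact existsUnique_mem_of_injOn_of_card_eq (key Prod.snd hs.col Prod.snd (by simp)) hc'
    · exact existsUnique_mem_of_injOn_of_card_eq
        (key _ hs.sym (fun p => M p.1 p.2) (by simp [hM])) hc'
  · intro s _ t _ hst
    exact Finset.map_injective _ hst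

section Prolong

variable {A S : Type*}

open Classical in
/-- Prolongation of `L` along the transversals `τ i`: the cells of `τ i` receive the new symbol `i`,
and the old symbols are projected to the new column `i` and the new row `i`. The corner is
filled with `C`. -/
noncomputable def prolong (L : A → A → A) (τ : S → Equiv.Perm A) (C : S → S → S) :
    A ⊕ S → A ⊕ S → A ⊕ S
  | .inl x, .inl y => if h : ∃ i, τ i x = y then .inr h.choose else .inl (L x y)
  | .inl x, .inr i => .inl (L x (τ i x))
  | .inr i, .inl y => .inl (L ((τ i).symm y) y)
  | .inr i, .inr j => .inr (C i j)

variable {L : A → A → A} {τ : S → Equiv.Perm A} {C : S → S → S}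

theorem prolong_inl_inl (x y : A) :
    (∃ i, τ i x = y ∧ prolong L τ C (.inl x) (.inl y) = .inr i) ∨
      ((∀ i, τ i x ≠ y) ∧ prolong L τ C (.inl x) (.inl y) = .inl (L x y)) := by
  by_cases h : ∃ i, τ i x = y
  · exact Or.inl ⟨h.choose, h.choose_spec, by simp [prolong, h]⟩
  · exact Or.inr ⟨not_exists.1 h, by simp [prolong, h]⟩

/-- Each old symbol displaced from a row or column by some `τ i` reappears in the new column or row
`i`. Disjointness of the `τ i` prevents a line from receiving it twice, and each `τ i` being a
transversal makes the new lines Latin. -/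
theorem isLatin_prolong (hL : IsLatin L) (hC : IsLatin C)
    (hτ : ∀ i, Function.Injective fun x => L x (τ i x))
    (hdisj : ∀ i j x, τ i x = τ j x → i = j) : IsLatin (prolong L τ C) := by
  have hτ' : ∀ i, Function.Injective fun y => L ((τ i).symm y) y := by
    intro i y y' h
    have := hτ i (a₁ := (τ i).symm y) (a₂ := (τ i).symm y') (by simpa using h)
    exact (τ i).symm.injective this
  have hdisj' : ∀ i j y, (τ i).symm y = (τ j).symm y → i = j := by
    intro i j y h
    refine hdisj i j ((τ i).symm y) ?_
    rw [Equiv.apply_symm_apply, h, Equiv.apply_symm_apply]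
  constructor
  · rintro (x | i) (y | j) (y' | j') h
    · obtain ⟨i, hi, e⟩ | ⟨hi, e⟩ := prolong_inl_inl (L := L) (τ := τ) (C := C) x y <;>
      obtain ⟨i', hi', e'⟩ | ⟨hi', e'⟩ := prolong_inl_inl (L := L) (τ := τ) (C := C) x y' <;>
      rw [e, e'] at h
      · rw [← hi, ← hi', Sum.inr_injective h]
      · cases h
      · cases h
      · rw [hL.row x (Sum.inl_injective h)]
    · obtain ⟨i, hi, e⟩ | ⟨hi, e⟩ := prolong_inl_inl (L := L) (τ := τ) (C := C) x y <;>
      rw [e] at h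
      · cases h
      · exact absurd (hL.row x (Sum.inl_injective h)).symm (hi j')
    · obtain ⟨i, hi, e⟩ | ⟨hi, e⟩ := prolong_inl_inl (L := L) (τ := τ) (C := C) x y' <;>
      rw [e] at h
      · cases h
      · exact absurd (hL.row x (Sum.inl_injective h)) (hi j)
    · rw [hdisj j j' x (hL.row x (Sum.inl_injective h))]
    · rw [hτ' i (Sum.inl_injective h)]
    · cases h
    · cases h
    · rw [hC.row i (Sum.inr_injective h)]
  · rintro (y | i) (x | j) (x' | j') h
    · obtain ⟨i, hi, e⟩ | ⟨hi, e⟩ := prolong_inl_inl (L := L) (τ := τ) (C := C) x y <;>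
      obtain ⟨i', hi', e'⟩ | ⟨hi', e'⟩ := prolong_inl_inl (L := L) (τ := τ) (C := C) x' y <;>
      simp only [e, e'] at h
      · cases h
        rw [(τ i).injective (hi.trans hi'.symm)]
      · cases h
      · cases h
      · rw [hL.col y (Sum.inl_injective h)]
    · obtain ⟨i, hi, e⟩ | ⟨hi, e⟩ := prolong_inl_inl (L := L) (τ := τ) (C := C) x y <;>
      simp only [e] at h
      · cases h
      · refine absurd ?_ (hi j')
        rw [hL.col y (Sum.inl_injective h), Equiv.apply_symm_apply]
    · obtain ⟨i, hi, e⟩ | ⟨hi, e⟩ := prolong_inl_inl (L := L) (τ := τ) (C := C) x' y <;>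
      simp only [e] at h
      · cases h
      · refine absurd ?_ (hi j)
        rw [← hL.col y (Sum.inl_injective h), Equiv.apply_symm_apply]
    · rw [hdisj' j j' y (hL.col y (Sum.inl_injective h))]
    · rw [hτ i (Sum.inl_injective h)]
    · cases h
    · cases h
    · rw [hC.col i (Sum.inr_injective h)]

/-- A transversal of `L` avoiding the `τ i` together with one of the corner gives a transversal
of the prolongation. -/
theorem card_partialTransversals_le_prolong [Fintype A] [Fintype S] {a b : ℕ}
    {t : Finset (S × S)} (ht : t ∈ partialTransversals C ∅ b) :
    (partialTransversals L {p | ∃ i, τ i p.1 = p.2} a).card ≤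
      (partialTransversals (prolong L τ C) ∅ (a + b)).card := by
  obtain ⟨htc, ht, -⟩ := mem_partialTransversals.1 ht
  let f : A × A ↪ (A ⊕ S) × (A ⊕ S) := Function.Embedding.inl.prodMap Function.Embedding.inl
  let g : S × S ↪ (A ⊕ S) × (A ⊕ S) := Function.Embedding.inr.prodMap Function.Embedding.inr
  have hdisj : ∀ s : Finset (A × A), Disjoint (s.map f) (t.map g) := by
    intro s
    rw [Finset.disjoint_left]
    intro p hp hq
    obtain ⟨p', -, rfl⟩ := Finset.mem_map.1 hp
    obtain ⟨q', -, h⟩ := Finset.mem_map.1 hq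
    exact Sum.inr_ne_inl (congrArg Prod.fst h)
  refine Finset.card_le_card_of_injOn (fun s => (s.map f).disjUnion (t.map g) (hdisj s)) ?_ ?_
  · intro s hs
    obtain ⟨hsc, hs, hbad⟩ := mem_partialTransversals.1 (Finset.mem_coe.1 hs)
    refine Finset.mem_coe.2 (mem_partialTransversals.2 ⟨by simp [hsc, htc], ?_, by simp⟩)
    have hsym : ∀ p ∈ s, prolong L τ C (.inl p.1) (.inl p.2) = .inl (L p.1 p.2) := by
      intro p hp
      obtain ⟨i, hi, -⟩ | ⟨-, e⟩ := prolong_inl_inl (L := L) (τ := τ) (C := C) p.1 p.2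
      · exact absurd ⟨i, hi⟩ (hbad p hp)
      · exact e
    have key : ∀ (u : A × A → A) (v : S × S → S) (r : (A ⊕ S) × (A ⊕ S) → A ⊕ S),
        Set.InjOn u s → Set.InjOn v t → (∀ p ∈ s, r (f p) = .inl (u p)) →
        (∀ p ∈ t, r (g p) = .inr (v p)) →
        Set.InjOn r ((s.map f).disjUnion (t.map g) (hdisj s) : Finset _) := by
      intro u v r hu hv h1 h2 p hp q hq hpq
      simp only [Finset.coe_disjUnion, Finset.coe_map, Set.mem_union, Set.mem_image,
        Finset.mem_coe] at hp hq
      obtain ⟨p, hp, rfl⟩ | ⟨p, hp, rfl⟩ := hp <;> obtain ⟨q, hq, rfl⟩ | ⟨q, hq, rfl⟩ := hq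
      · rw [h1 p hp, h1 q hq] at hpq
        rw [hu hp hq (Sum.inl_injective hpq)]
      · rw [h1 p hp, h2 q hq] at hpq
        cases hpq
      · rw [h2 p hp, h1 q hq] at hpq
        cases hpq
      · rw [h2 p hp, h2 q hq] at hpq
        rw [hv hp hq (Sum.inr_injective hpq)]
    exact ⟨key _ _ _ hs.row ht.row (fun _ _ => rfl) fun _ _ => rfl,
      key _ _ _ hs.col ht.col (fun _ _ => rfl) fun _ _ => rfl,
      key _ _ _ hs.sym ht.sym hsym fun _ _ => rfl⟩
  · intro s _ s' _ h
    ext p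
    have hp : ∀ s : Finset (A × A), p ∈ s ↔ f p ∈ (s.map f).disjUnion (t.map g) (hdisj s) := by
      intro s
      rw [Finset.mem_disjUnion, Finset.mem_map' f]
      refine ⟨Or.inl, fun h => h.resolve_right fun h => ?_⟩
      obtain ⟨q, -, h⟩ := Finset.mem_map.1 h
      exact Sum.inr_ne_inl (congrArg Prod.fst h)
    rw [hp s, hp s']
    exact iff_of_eq (congrArg (f p ∈ ·) h)

end Prolong

/-! ### Cyclic squares of odd order and the corner square -/

theorem isLatin_add (A : Type*) [AddGroup A] : IsLatin fun x y : A => x + y :=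
  ⟨fun x => add_right_injective x, fun y => add_left_injective y⟩

theorem ZMod.injective_add_self {k : ℕ} (hk : Odd k) :
    Function.Injective fun x : ZMod k => x + x := by
  intro x y h
  have hu : IsUnit ((2 : ℕ) : ZMod k) :=
    (ZMod.isUnit_iff_coprime 2 k).2 (Nat.coprime_two_left.2 hk)
  refine hu.mul_left_cancel ?_
  simpa [two_mul] using h

theorem graph_mem_partialTransversals {k : ℕ} [NeZero k] (hk : Odd k) (c : ZMod k)
    {bad : Set (ZMod k × ZMod k)} (hbad : ∀ x, (x, x + c) ∉ bad) :
    Finset.univ.map ⟨fun x : ZMod k => (x, x + c), fun _ _ h => congrArg Prod.fst h⟩ ∈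
      partialTransversals (fun x y : ZMod k => x + y) bad k := by
  refine mem_partialTransversals.2 ⟨by simp, ⟨?_, ?_, ?_⟩, ?_⟩
  · intro p hp q hq h
    simp only [Finset.coe_map, Finset.coe_univ, Set.image_univ, Set.mem_range] at hp hq
    obtain ⟨x, rfl⟩ := hp
    obtain ⟨y, rfl⟩ := hq
    replace h : x = y := h
    rw [h]
  · intro p hp q hq h
    simp only [Finset.coe_map, Finset.coe_univ, Set.image_univ, Set.mem_range] at hp hq
    obtain ⟨x, rfl⟩ := hp
    obtain ⟨y, rfl⟩ := hq
    replace h : x + c = y + c := h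
    rw [add_right_cancel h]
  · intro p hp q hq h
    simp only [Finset.coe_map, Finset.coe_univ, Set.image_univ, Set.mem_range] at hp hq
    obtain ⟨x, rfl⟩ := hp
    obtain ⟨y, rfl⟩ := hq
    replace h : x + (x + c) = y + (y + c) := h
    rw [← add_assoc, ← add_assoc] at h
    have hxy : x = y := ZMod.injective_add_self hk (add_right_cancel h)
    rw [hxy]
  · intro p hp
    obtain ⟨x, -, rfl⟩ := Finset.mem_map.1 hp
    exact hbad x

/-- For odd `s` the table of Z_s works. For even `s`, prolong Z_(s-1) along `y = x`; the transversal
`y = x + 1` avoids it because `s - 1 > 1`, and the corner cell completes it. -/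
theorem exists_isLatin_with_transversal {s : ℕ} (hs : 3 ≤ s) :
    ∃ (S : Type) (_ : Fintype S) (C : S → S → S), Fintype.card S = s ∧ IsLatin C ∧
      (partialTransversals C ∅ s).Nonempty := by
  rcases Nat.even_or_odd s with h | h
  · obtain ⟨k, rfl⟩ : ∃ k, s = k + 1 := ⟨s - 1, by omega⟩
    have hk : Odd k := by
      rw [← Nat.not_even_iff_odd]
      exact fun hk => (Nat.even_add_one.1 h) hk
    have : NeZero k := ⟨by omega⟩
    have : Fact (1 < k) := ⟨by omega⟩
    let τ : Unit → Equiv.Perm (ZMod k) := fun _ => Equiv.refl _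
    let C : Unit → Unit → Unit := fun _ _ => ()
    refine ⟨ZMod k ⊕ Unit, inferInstance, prolong (fun x y => x + y) τ C, by simp [ZMod.card],
      ?_, ?_⟩
    · refine isLatin_prolong (isLatin_add _) ⟨fun _ _ _ _ => rfl, fun _ _ _ _ => rfl⟩
        (fun _ => ZMod.injective_add_self hk) (fun _ _ _ _ => rfl)
    · have ht : {((), ())} ∈ partialTransversals C ∅ 1 :=
        mem_partialTransversals.2 ⟨by simp, ⟨by simp, by simp, by simp⟩, by simp⟩
      have hle := card_partialTransversals_le_prolong (L := fun x y : ZMod k => x + y) (τ := τ)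
        (a := k) ht
      refine Finset.card_pos.1 (lt_of_lt_of_le (Finset.card_pos.2 ⟨_,
        graph_mem_partialTransversals hk 1 ?_⟩) hle)
      rintro x ⟨i, hi⟩
      simp [τ] at hi
  · have : NeZero s := ⟨by omega⟩
    exact ⟨ZMod s, inferInstance, fun x y => x + y, ZMod.card s, isLatin_add _,
      _, graph_mem_partialTransversals h 0 (by simp)⟩

/-! ### Counting small partial transversals greedily -/

section Greedy

variable {B : Type*} [Fintype B] {K : B → B → B}

theorem card_cells_eq_le [DecidableEq B] {f g : B × B → B}
    (h : ∀ p q, f p = f q → g p = g q → p = q) (c : B) :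
    (Finset.univ.filter fun q => f q = c).card ≤ Fintype.card B := by
  rw [← Finset.card_univ]
  refine Finset.card_le_card_of_injOn g (fun _ _ => Finset.mem_univ _) fun p hp q hq hpq => ?_
  simp only [Finset.coe_filter, Finset.mem_univ, true_and, Set.mem_ofPred_eq] at hp hq
  exact h p q (hp.trans hq.symm) hpq

open Classical in
-- Each cell of `s` excludes only the cells sharing its row, column or symbol, at most `|B|` of each
-- kind.
theorem card_extensions_ge (hK : IsLatin K) (bad : Finset (B × B)) (s : Finset (B × B)) :
    Fintype.card B ^ 2 - (bad.card + 3 * s.card * Fintype.card B) ≤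
      (Finset.univ.filter fun c : B × B =>
        c ∉ bad ∧ ∀ p ∈ s, c.1 ≠ p.1 ∧ c.2 ≠ p.2 ∧ K c.1 c.2 ≠ K p.1 p.2).card := by
  let U : (B × B → B) → Finset (B × B) := fun f =>
    s.biUnion fun p => Finset.univ.filter fun q => f q = f p
  have hU : ∀ f g : B × B → B, (∀ p q, f p = f q → g p = g q → p = q) →
      (U f).card ≤ s.card * Fintype.card B := fun f g h =>
    Finset.card_biUnion_le_card_mul _ _ _ fun p _ => card_cells_eq_le h _
  have h1 := hU Prod.fst Prod.snd fun p q h h' => Prod.ext h h'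
  have h2 := hU Prod.snd Prod.fst fun p q h h' => Prod.ext h' h
  have h3 := hU (fun q => K q.1 q.2) Prod.fst fun p q h h' => by
    refine Prod.ext h' (hK.row p.1 ?_)
    rw [h, h']
  have hcover : (Finset.univ : Finset (B × B)) ⊆ (Finset.univ.filter fun c : B × B =>
        c ∉ bad ∧ ∀ p ∈ s, c.1 ≠ p.1 ∧ c.2 ≠ p.2 ∧ K c.1 c.2 ≠ K p.1 p.2) ∪
      (bad ∪ (U Prod.fst ∪ (U Prod.snd ∪ U fun q => K q.1 q.2))) := by
    intro c _
    by_contra hc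
    simp only [U, Finset.mem_union, Finset.mem_filter, Finset.mem_univ, true_and,
      Finset.mem_biUnion, not_or, not_exists, not_and] at hc
    exact hc.1 hc.2.1 fun p hp => ⟨hc.2.2.1 p hp, hc.2.2.2.1 p hp, hc.2.2.2.2 p hp⟩
  have hcard := (Finset.card_le_card hcover).trans
    ((Finset.card_union_le _ _).trans (Nat.add_le_add_left ((Finset.card_union_le _ _).trans
      (Nat.add_le_add_left ((Finset.card_union_le _ _).trans
        (Nat.add_le_add_left (Finset.card_union_le _ _) _)) _)) _))
  rw [Finset.card_univ, Fintype.card_prod, ← sq] at hcard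
  have : 3 * s.card * Fintype.card B = s.card * Fintype.card B + (s.card * Fintype.card B +
    s.card * Fintype.card B) := by ring
  omega

theorem card_partialTransversals_succ_ge (hK : IsLatin K) (bad : Finset (B × B)) (w : ℕ) :
    (partialTransversals K bad w).card *
        (Fintype.card B ^ 2 - (bad.card + 3 * w * Fintype.card B)) ≤
      (partialTransversals K bad (w + 1)).card * (w + 1) := by
  classical
  let E : Finset (B × B) → Finset (B × B) := fun s => Finset.univ.filter fun c : B × B =>
        c ∉ bad ∧ ∀ p ∈ s, c.1 ≠ p.1 ∧ c.2 ≠ p.2 ∧ K c.1 c.2 ≠ K p.1 p.2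
  have hE : ∀ s c, c ∈ E s ↔
      c ∉ bad ∧ ∀ p ∈ s, c.1 ≠ p.1 ∧ c.2 ≠ p.2 ∧ K c.1 c.2 ≠ K p.1 p.2 := by simp [E]
  have hnot : ∀ s c, c ∈ E s → c ∉ s := fun s c hc hcs => (((hE s c).1 hc).2 c hcs).1 rfl
  calc _ ≤ ∑ s ∈ partialTransversals K bad w, (E s).card := by
        rw [← smul_eq_mul]
        refine Finset.card_nsmul_le_sum _ _ _ fun s hs => ?_
        rw [← (mem_partialTransversals.1 hs).1]
        convert card_extensions_ge hK bad s
    _ = ((partialTransversals K bad w).sigma E).card := (Finset.card_sigma _ _).symm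
    -- Double counting: `(s, c) ↦ (insert c s, c)` is injective, and each image set has only `w + 1`
    -- cells to mark.
    _ ≤ ((partialTransversals K bad (w + 1)).sigma fun t => t).card := by
        refine Finset.card_le_card_of_injOn (fun x => ⟨insert x.2 x.1, x.2⟩) ?_ ?_
        · rintro ⟨s, c⟩ hx
          obtain ⟨hs, hc⟩ := Finset.mem_sigma.1 (Finset.mem_coe.1 hx)
          obtain ⟨hsw, hs, hbad⟩ := mem_partialTransversals.1 hs
          have hcs := hnot s c hc
          obtain ⟨hcb, hc⟩ := (hE s c).1 hc
          refine Finset.mem_coe.2 (Finset.mem_sigma.2 ⟨mem_partialTransversals.2 ⟨?_, ⟨?_, ?_, ?_⟩,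
            ?_⟩, Finset.mem_insert_self _ _⟩)
          · rw [Finset.card_insert_of_notMem hcs, hsw]
          · rw [Finset.coe_insert, Set.injOn_insert hcs]
            exact ⟨hs.row, by rintro ⟨p, hp, h⟩; exact (hc p hp).1 h.symm⟩
          · rw [Finset.coe_insert, Set.injOn_insert hcs]
            exact ⟨hs.col, by rintro ⟨p, hp, h⟩; exact (hc p hp).2.1 h.symm⟩
          · rw [Finset.coe_insert, Set.injOn_insert hcs]
            exact ⟨hs.sym, by rintro ⟨p, hp, h⟩; exact (hc p hp).2.2 h.symm⟩
          · intro p hp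
            rcases Finset.mem_insert.1 hp with rfl | hp
            · exact hcb
            · exact hbad p hp
        · rintro ⟨s, c⟩ hx ⟨s', c'⟩ hx' h
          have hc := hnot s c (Finset.mem_sigma.1 (Finset.mem_coe.1 hx)).2
          have hc' := hnot s' c' (Finset.mem_sigma.1 (Finset.mem_coe.1 hx')).2
          simp only [Sigma.mk.injEq, heq_eq_eq] at h
          obtain ⟨h, rfl⟩ := h
          rw [← Finset.erase_insert hc, h, Finset.erase_insert hc']
    _ = _ := by
        rw [Finset.card_sigma, Finset.sum_congr rfl fun t ht => (mem_partialTransversals.1 ht).1,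
          Finset.sum_const, smul_eq_mul]

theorem card_partialTransversals_mul_factorial_ge (hK : IsLatin K) (bad : Finset (B × B)) (w : ℕ) :
    (Fintype.card B ^ 2 - (bad.card + 3 * w * Fintype.card B)) ^ w ≤
      (partialTransversals K bad w).card * w.factorial := by
  suffices h : ∀ j ≤ w, (Fintype.card B ^ 2 - (bad.card + 3 * w * Fintype.card B)) ^ j ≤
      (partialTransversals K bad j).card * j.factorial from h w le_rfl
  intro j hj
  induction j with
  | zero =>
    have : ∅ ∈ partialTransversals K bad 0 :=
      mem_partialTransversals.2 ⟨by simp, ⟨by simp, by simp, by simp⟩, by simp⟩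
    simpa using Finset.card_pos.2 ⟨_, this⟩
  | succ j ih =>
    have h1 := ih (by omega)
    have h2 := card_partialTransversals_succ_ge hK bad j
    have h3 : Fintype.card B ^ 2 - (bad.card + 3 * w * Fintype.card B) ≤
        Fintype.card B ^ 2 - (bad.card + 3 * j * Fintype.card B) := by
      have : 3 * j * Fintype.card B ≤ 3 * w * Fintype.card B := by gcongr; omega
      omega
    calc _ = (Fintype.card B ^ 2 - (bad.card + 3 * w * Fintype.card B)) ^ j *
          (Fintype.card B ^ 2 - (bad.card + 3 * w * Fintype.card B)) := pow_succ _ _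
      _ ≤ (partialTransversals K bad j).card * j.factorial *
          (Fintype.card B ^ 2 - (bad.card + 3 * j * Fintype.card B)) := Nat.mul_le_mul h1 h3
      _ = (partialTransversals K bad j).card *
          (Fintype.card B ^ 2 - (bad.card + 3 * j * Fintype.card B)) * j.factorial := by ring
      _ ≤ (partialTransversals K bad (j + 1)).card * (j + 1) * j.factorial :=
          Nat.mul_le_mul_right _ h2
      _ = _ := by rw [Nat.factorial_succ]; ring

end Greedy

/-! ### Randomly scrambled block squares -/

section Block

variable {A B : Type*}

/-- The images of the sets `R b` under the permutations `α b` are pairwise disjoint. -/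
def Scatters (α : A → Equiv.Perm B) (R : A → Finset B) : Prop :=
  ∀ b b' x x', x ∈ R b → x' ∈ R b' → α b x = α b' x' → b = b'

open Classical in
-- Since `|A| * w = |B|`, scattered images partition `B`. Each bijection `θ : A × Fin w ≃ B`
-- prescribes where every `R b` goes and leaves `(|B| - w)!` extensions per `b`; distinct `θ` give
-- disjoint families.
theorem card_scatters_ge [Fintype A] [Fintype B] {w : ℕ}
    (hw : Fintype.card A * w = Fintype.card B) {R : A → Finset B} (hR : ∀ b, (R b).card = w) :
    (Fintype.card B).factorial * (Fintype.card B - w).factorial ^ Fintype.card A ≤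
      (Finset.univ.filter fun α : A → Equiv.Perm B => Scatters α R).card := by
  let e : ∀ b, Fin w ≃ R b := fun b => ((R b).equivFinOfCardEq (hR b)).symm
  let F : (A × Fin w ≃ B) → Finset (A → Equiv.Perm B) := fun θ =>
    Fintype.piFinset fun b => Finset.univ.filter fun α : Equiv.Perm B =>
      ∀ i, α (e b i) = θ (b, i)
  have hmem : ∀ θ α, α ∈ F θ ↔ ∀ b i, α b (e b i) = θ (b, i) := by
    intro θ α
    simp [F, Fintype.mem_piFinset]
  have hF : ∀ θ, (F θ).card = (Fintype.card B - w).factorial ^ Fintype.card A := by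
    intro θ
    rw [Fintype.card_piFinset, ← Finset.card_univ (α := A), ← Finset.prod_const]
    refine Finset.prod_congr rfl fun b _ => ?_
    have h := card_perm_extending (B := B) (ι := Fin w) (u := fun i => (e b i : B))
      (v := fun i => θ (b, i)) (Subtype.val_injective.comp (e b).injective)
      (fun i j h => congrArg Prod.snd (θ.injective h))
    rw [Fintype.card_fin] at h
    convert h
  have hdisj : Set.PairwiseDisjoint ((Finset.univ : Finset (A × Fin w ≃ B)) : Set _) F := by
    intro θ _ θ' _ hne
    refine Finset.disjoint_left.2 fun α h h' => hne ?_
    ext ⟨b, i⟩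
    rw [← (hmem θ α).1 h b i, (hmem θ' α).1 h' b i]
  have hcard : Fintype.card (A × Fin w ≃ B) = (Fintype.card B).factorial := by
    have h : Fintype.card (A × Fin w) = Fintype.card B := by simpa using hw
    rw [Fintype.card_equiv (Fintype.equivOfCardEq h), h]
  have hbU := Finset.card_biUnion hdisj
  rw [Finset.sum_congr rfl fun θ _ => hF θ, Finset.sum_const, smul_eq_mul, Finset.card_univ,
    hcard] at hbU
  rw [← hbU]
  refine Finset.card_le_card fun α hα => ?_
  obtain ⟨θ, -, hθ⟩ := Finset.mem_biUnion.1 hα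
  have hθ := (hmem θ α).1 hθ
  refine Finset.mem_filter.2 ⟨Finset.mem_univ _, fun b b' x x' hx hx' h => ?_⟩
  have h1 := hθ b ((e b).symm ⟨x, hx⟩)
  have h2 := hθ b' ((e b').symm ⟨x', hx'⟩)
  rw [Equiv.apply_symm_apply] at h1 h2
  have h3 := θ.injective (h1.symm.trans (h.trans h2))
  exact congrArg Prod.fst h3

open Classical in
theorem card_forall_scatters_ge [Fintype A] [Fintype B] {w : ℕ}
    (hw : Fintype.card A * w = Fintype.card B) {R : A → A → Finset B}
    (hR : ∀ a b, (R a b).card = w) :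
    ((Fintype.card B).factorial * (Fintype.card B - w).factorial ^ Fintype.card A) ^
        Fintype.card A ≤
      (Finset.univ.filter fun α : A → A → Equiv.Perm B => ∀ a, Scatters (α a) (R a)).card := by
  have : (Finset.univ.filter fun α : A → A → Equiv.Perm B => ∀ a, Scatters (α a) (R a)) =
      Fintype.piFinset fun a => Finset.univ.filter fun α : A → Equiv.Perm B =>
        Scatters α (R a) := by
    ext α
    simp [Fintype.mem_piFinset]
  rw [this, Fintype.card_piFinset, ← Finset.card_univ (α := A), ← Finset.prod_const,
    Finset.card_univ]
  exact Finset.prod_le_prod' fun a _ => card_scatters_ge hw (hR a)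

open Classical in
/-- The cells of the block square whose position inside their block is prescribed by `p`. -/
noncomputable def blockCells [Fintype A] [Fintype B] (α β : A → A → Equiv.Perm B)
    (p : A → A → Finset (B × B)) : Finset ((A × B) × (A × B)) :=
  Finset.univ.filter fun c =>
    ((α c.1.1 c.2.1).symm c.1.2, (β c.2.1 c.1.1).symm c.2.2) ∈ p c.1.1 c.2.1

theorem mem_blockCells [Fintype A] [Fintype B] {α β : A → A → Equiv.Perm B} {p : A → A → Finset (B × B)} {a b : A}
    {x y : B} : ((a, x), (b, y)) ∈ blockCells α β p ↔
      ((α a b).symm x, (β b a).symm y) ∈ p a b := by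
  simp [blockCells]

variable [AddCommGroup A] (K : B → B → B)

/-- The Latin square on `A × B` obtained from the addition table of `A` by replacing each cell with
an isotopic copy of `K`. -/
def blockSquare (α β γ : A → A → Equiv.Perm B) (p q : A × B) : A × B :=
  (p.1 + q.1, γ (p.1 + q.1) p.1 (K ((α p.1 q.1).symm p.2) ((β q.1 p.1).symm q.2)))

theorem isLatin_blockSquare {K : B → B → B} (hK : IsLatin K) (α β γ : A → A → Equiv.Perm B) :
    IsLatin (blockSquare K α β γ) := by
  constructor
  · rintro ⟨a, x⟩ ⟨b, y⟩ ⟨b', y'⟩ h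
    simp only [blockSquare, Prod.mk.injEq, add_right_inj] at h
    obtain ⟨rfl, h⟩ := h
    rw [(β b a).symm.injective (hK.row _ ((γ _ _).injective h))]
  · rintro ⟨b, y⟩ ⟨a, x⟩ ⟨a', x'⟩ h
    simp only [blockSquare, Prod.mk.injEq, add_left_inj] at h
    obtain ⟨rfl, h⟩ := h
    rw [(α a b).symm.injective (hK.col _ ((γ _ _).injective h))]

end Block

/-! ### Assembling transversals from blocks and averaging over scramblings -/

section BlockCount

variable {A B : Type*} [Fintype A] [Fintype B]

theorem card_blockCells {α β : A → A → Equiv.Perm B} {p : A → A → Finset (B × B)} {w : ℕ}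
    (hp : ∀ a b, (p a b).card = w) :
    (blockCells α β p).card = Fintype.card A * Fintype.card A * w := by
  classical
  rw [Finset.card_eq_sum_card_fiberwise (f := fun c => (c.1.1, c.2.1))
    (t := (Finset.univ : Finset (A × A))) (fun _ _ => Finset.mem_coe.2 (Finset.mem_univ _))]
  rw [Finset.sum_congr rfl (g := fun _ => w)]
  · simp
  · rintro ⟨a, b⟩ -
    rw [← hp a b]
    refine Finset.card_nbij' (fun c => ((α a b).symm c.1.2, (β b a).symm c.2.2))
      (fun q => ((a, α a b q.1), (b, β b a q.2))) ?_ ?_ ?_ ?_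
    · rintro ⟨⟨a', x⟩, ⟨b', y⟩⟩ hc
      obtain ⟨h1, h2⟩ := Finset.mem_filter.1 (Finset.mem_coe.1 hc)
      cases h2
      exact mem_blockCells.1 h1
    · rintro ⟨x, y⟩ hq
      exact Finset.mem_coe.2 (Finset.mem_filter.2 ⟨mem_blockCells.2 (by simpa using hq), rfl⟩)
    · rintro ⟨⟨a', x⟩, ⟨b', y⟩⟩ hc
      obtain ⟨h1, h2⟩ := Finset.mem_filter.1 (Finset.mem_coe.1 hc)
      cases h2
      simp
    · rintro ⟨x, y⟩ _
      simp

theorem blockCells_injective (α β : A → A → Equiv.Perm B) :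
    Function.Injective (blockCells α β) := by
  intro p p' h
  funext a b
  ext ⟨x, y⟩
  have h1 := mem_blockCells (α := α) (β := β) (p := p) (a := a) (b := b) (x := α a b x)
    (y := β b a y)
  have h2 := mem_blockCells (α := α) (β := β) (p := p') (a := a) (b := b) (x := α a b x)
    (y := β b a y)
  simp only [Equiv.symm_apply_apply] at h1 h2
  rw [← h1, ← h2, h]

variable [AddCommGroup A]

/-- Two chosen cells sharing a row, column or symbol lie in the same block by the scattering
hypotheses, and there they coincide. The blocks carrying symbol class `c` are the `(a, c - a)`. -/
theorem isPartialTransversal_blockCells [DecidableEq B] {K : B → B → B} {α β γ : A → A → Equiv.Perm B}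
    {p : A → A → Finset (B × B)} (hp : ∀ a b, IsPartialTransversal K (p a b))
    (hα : ∀ a, Scatters (α a) fun b => (p a b).image Prod.fst)
    (hβ : ∀ b, Scatters (β b) fun a => (p a b).image Prod.snd)
    (hγ : ∀ c, Scatters (γ c) fun a => (p a (c - a)).image fun q => K q.1 q.2) :
    IsPartialTransversal (blockSquare K α β γ) (blockCells α β p) := by
  refine ⟨?_, ?_, ?_⟩
  · rintro ⟨⟨a, x⟩, ⟨b, y⟩⟩ hc ⟨⟨a', x'⟩, ⟨b', y'⟩⟩ hc' h
    cases h
    replace hc := mem_blockCells.1 (Finset.mem_coe.1 hc)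
    replace hc' := mem_blockCells.1 (Finset.mem_coe.1 hc')
    obtain rfl : b = b' := hα a b b' _ _ (Finset.mem_image_of_mem _ hc)
      (Finset.mem_image_of_mem _ hc') (by simp)
    have h := congrArg Prod.snd ((hp a b).row hc hc' rfl)
    rw [(β b a).symm.injective h]
  · rintro ⟨⟨a, x⟩, ⟨b, y⟩⟩ hc ⟨⟨a', x'⟩, ⟨b', y'⟩⟩ hc' h
    cases h
    replace hc := mem_blockCells.1 (Finset.mem_coe.1 hc)
    replace hc' := mem_blockCells.1 (Finset.mem_coe.1 hc')
    obtain rfl : a = a' := hβ b a a' _ _ (Finset.mem_image_of_mem _ hc)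
      (Finset.mem_image_of_mem _ hc') (by simp)
    have h := congrArg Prod.fst ((hp a b).col hc hc' rfl)
    rw [(α a b).symm.injective h]
  · rintro ⟨⟨a, x⟩, ⟨b, y⟩⟩ hc ⟨⟨a', x'⟩, ⟨b', y'⟩⟩ hc' h
    replace hc := mem_blockCells.1 (Finset.mem_coe.1 hc)
    replace hc' := mem_blockCells.1 (Finset.mem_coe.1 hc')
    simp only [blockSquare, Prod.mk.injEq] at h
    obtain ⟨hab, h⟩ := h
    have hb : b = a + b - a := by abel
    have hb' : b' = a + b - a' := by rw [hab]; abel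
    rw [← hab] at h
    obtain rfl : a = a' := by
      refine hγ (a + b) a a' (K ((α a b).symm x) ((β b a).symm y))
        (K ((α a' b').symm x') ((β b' a').symm y')) (Finset.mem_image.2 ⟨(_, _), ?_, rfl⟩)
        (Finset.mem_image.2 ⟨(_, _), ?_, rfl⟩) h
      · rw [← hb]; exact hc
      · rw [← hb']; exact hc'
    obtain rfl : b = b' := add_left_cancel hab
    have h := (hp a b).sym hc hc' ((γ _ _).injective h)
    simp only [Prod.mk.injEq, EmbeddingLike.apply_eq_iff_eq] at h
    rw [h.1, h.2]

/-- Averaging over all scramblings: some block square has many transversals which inside every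
block avoid the cells coming from `bad`. -/
theorem exists_blockSquare_many_transversals (K : B → B → B) (bad : Set (B × B)) {w : ℕ}
    (hw : Fintype.card A * w = Fintype.card B) :
    ∃ α β γ : A → A → Equiv.Perm B,
      (partialTransversals K bad w).card ^ (Fintype.card A * Fintype.card A) *
          (((Fintype.card B).factorial * (Fintype.card B - w).factorial ^ Fintype.card A) ^
            Fintype.card A) ^ 3 ≤
        (partialTransversals (blockSquare K α β γ)
          {c | ((α c.1.1 c.2.1).symm c.1.2, (β c.2.1 c.1.1).symm c.2.2) ∈ bad}
          (Fintype.card A * Fintype.card B)).card *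
        ((Fintype.card B).factorial ^ (Fintype.card A * Fintype.card A)) ^ 3 := by
  classical
  set m := Fintype.card A
  set k := Fintype.card B
  set Q := (k.factorial * (k - w).factorial ^ m) ^ m
  let G := A → A → Equiv.Perm B
  let T : G × G × G → ℕ := fun g => (partialTransversals (blockSquare K g.1 g.2.1 g.2.2)
    {c | ((g.1 c.1.1 c.2.1).symm c.1.2, (g.2.1 c.2.1 c.1.1).symm c.2.2) ∈ bad} (m * k)).card
  let F : Finset (A → A → Finset (B × B)) :=
    Fintype.piFinset fun _ => Fintype.piFinset fun _ => partialTransversals K bad w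
  have hF : ∀ p, p ∈ F ↔ ∀ a b, p a b ∈ partialTransversals K bad w := by
    simp [F, Fintype.mem_piFinset]
  have hFcard : F.card = (partialTransversals K bad w).card ^ (m * m) := by
    simp only [F, Fintype.card_piFinset, Finset.prod_const, Finset.card_univ]
    rw [← pow_mul]
  let compat : G × G × G → (A → A → Finset (B × B)) → Prop := fun g p =>
    (∀ a, Scatters (g.1 a) fun b => (p a b).image Prod.fst) ∧
    (∀ b, Scatters (g.2.1 b) fun a => (p a b).image Prod.snd) ∧
    (∀ c, Scatters (g.2.2 c) fun a => (p a (c - a)).image fun q => K q.1 q.2)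
  have hG : Fintype.card G = k.factorial ^ (m * m) := by
    simp only [G, Fintype.card_fun, Fintype.card_perm]
    rw [← pow_mul]
  have h1 : ∀ g, (F.filter (compat g)).card ≤ T g := by
    rintro ⟨α, β, γ⟩
    refine Finset.card_le_card_of_injOn (blockCells α β) ?_ (blockCells_injective α β).injOn
    intro p hp
    obtain ⟨hp, hα, hβ, hγ⟩ := Finset.mem_filter.1 (Finset.mem_coe.1 hp)
    have hp := fun a b => mem_partialTransversals.1 ((hF p).1 hp a b)
    refine Finset.mem_coe.2 (mem_partialTransversals.2 ⟨?_,
      isPartialTransversal_blockCells (fun a b => (hp a b).2.1) hα hβ hγ, ?_⟩)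
    · rw [card_blockCells fun a b => (hp a b).1, mul_assoc, hw]
    · rintro ⟨⟨a, x⟩, ⟨b, y⟩⟩ hc
      exact (hp a b).2.2 _ (mem_blockCells.1 hc)
  have h2 : ∀ p ∈ F, Q ^ 3 ≤ (Finset.univ.filter fun g => compat g p).card := by
    intro p hp
    have hp := fun a b => mem_partialTransversals.1 ((hF p).1 hp a b)
    have e : (Finset.univ.filter fun g => compat g p) =
        (Finset.univ.filter fun α : G => ∀ a, Scatters (α a) fun b => (p a b).image Prod.fst) ×ˢ
        ((Finset.univ.filter fun β : G => ∀ b, Scatters (β b) fun a => (p a b).image Prod.snd) ×ˢ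
        (Finset.univ.filter fun γ : G =>
          ∀ c, Scatters (γ c) fun a => (p a (c - a)).image fun q => K q.1 q.2)) := by
      ext ⟨α, β, γ⟩
      simp [compat]
    rw [e, Finset.card_product, Finset.card_product, pow_succ', sq]
    refine Nat.mul_le_mul ?_ (Nat.mul_le_mul ?_ ?_)
    · exact card_forall_scatters_ge hw fun a b => by
        rw [Finset.card_image_of_injOn (hp a b).2.1.row, (hp a b).1]
    · exact card_forall_scatters_ge hw fun b a => by
        rw [Finset.card_image_of_injOn (hp a b).2.1.col, (hp a b).1]
    · exact card_forall_scatters_ge hw fun c a => by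
        rw [Finset.card_image_of_injOn (hp a (c - a)).2.1.sym, (hp a (c - a)).1]
  -- Count compatible pairs of scrambling and choice. If every scrambling fell below the average,
  -- summing over scramblings would contradict the count made choice by choice.
  by_contra! hlt
  have hsum : F.card * Q ^ 3 ≤ ∑ g, T g := by
    calc _ ≤ ∑ p ∈ F, (Finset.univ.filter fun g => compat g p).card := by
          rw [← smul_eq_mul]
          exact Finset.card_nsmul_le_sum _ _ _ h2
      _ = ∑ g, (F.filter (compat g)).card := by
          simp only [Finset.card_filter]
          exact Finset.sum_comm
      _ ≤ _ := Finset.sum_le_sum fun g _ => h1 g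
  have hGcard : Fintype.card (G × G × G) = (k.factorial ^ (m * m)) ^ 3 := by
    rw [Fintype.card_prod, Fintype.card_prod, hG]
    ring
  have hlt' : ∑ g, T g * (k.factorial ^ (m * m)) ^ 3 <
      ∑ _g : G × G × G, F.card * Q ^ 3 := by
    refine Finset.sum_lt_sum_of_nonempty ⟨(1, 1, 1), Finset.mem_univ _⟩ fun g _ => ?_
    rw [hFcard]
    exact hlt g.1 g.2.1 g.2.2
  rw [← Finset.sum_mul, Finset.sum_const, Finset.card_univ, hGcard, smul_eq_mul, mul_comm] at hlt'
  exact absurd (Nat.lt_of_mul_lt_mul_left hlt') (not_lt.2 hsum)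

/-- Clean form of the averaging bound: `k! / (k - w)! ≤ k ^ w` shows that each of the three
scattering conditions costs at most a factor `k ^ (m * k) / k! ^ m`. -/
theorem exists_blockSquare_card_mul_pow_ge (K : B → B → B) (bad : Set (B × B)) {w : ℕ}
    (hw : Fintype.card A * w = Fintype.card B) :
    ∃ α β γ : A → A → Equiv.Perm B,
      (partialTransversals K bad w).card ^ (Fintype.card A * Fintype.card A) *
          (Fintype.card B).factorial ^ (3 * Fintype.card A) ≤
        (partialTransversals (blockSquare K α β γ)
          {c | ((α c.1.1 c.2.1).symm c.1.2, (β c.2.1 c.1.1).symm c.2.2) ∈ bad}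
          (Fintype.card A * Fintype.card B)).card *
        Fintype.card B ^ (3 * (Fintype.card A * Fintype.card B)) := by
  obtain ⟨α, β, γ, h⟩ := exists_blockSquare_many_transversals (A := A) K bad hw
  refine ⟨α, β, γ, ?_⟩
  set T := (partialTransversals (blockSquare K α β γ)
          {c | ((α c.1.1 c.2.1).symm c.1.2, (β c.2.1 c.1.1).symm c.2.2) ∈ bad}
          (Fintype.card A * Fintype.card B)).card
  set P := (partialTransversals K bad w).card
  have hm : 1 ≤ Fintype.card A := Fintype.card_pos_iff.2 ⟨0⟩
  set m := Fintype.card A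
  set k := Fintype.card B
  have hwk : w ≤ k := by
    rw [← hw]
    exact Nat.le_mul_of_pos_left _ hm
  have hdesc : k.factorial ≤ (k - w).factorial * k ^ w := by
    rw [← Nat.factorial_mul_descFactorial hwk]
    exact Nat.mul_le_mul_left _ (Nat.descFactorial_le_pow _ _)
  have hkk : (k.factorial * k.factorial ^ m) ^ m ≤
      (k.factorial * (k - w).factorial ^ m) ^ m * k ^ (m * k) := by
    calc (k.factorial * k.factorial ^ m) ^ m
        ≤ (k.factorial * ((k - w).factorial * k ^ w) ^ m) ^ m := by gcongr
      _ = (k.factorial * (k - w).factorial ^ m) ^ m * k ^ (m * (m * w)) := by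
          rw [mul_pow, mul_pow, mul_pow, mul_pow, ← pow_mul k, ← pow_mul k]
          ring_nf
      _ = _ := by rw [hw]
  have hpos : 0 < (k.factorial ^ (m * m)) ^ 3 := by positivity
  refine Nat.le_of_mul_le_mul_right ?_ hpos
  calc P ^ (m * m) * k.factorial ^ (3 * m) * (k.factorial ^ (m * m)) ^ 3
      = P ^ (m * m) * ((k.factorial * k.factorial ^ m) ^ m) ^ 3 := by
        rw [mul_pow (k.factorial), ← pow_mul, ← pow_mul, mul_pow, ← pow_mul, ← pow_mul]
        ring
    _ ≤ P ^ (m * m) * ((k.factorial * (k - w).factorial ^ m) ^ m * k ^ (m * k)) ^ 3 := by gcongr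
    _ = P ^ (m * m) * ((k.factorial * (k - w).factorial ^ m) ^ m) ^ 3 * k ^ (3 * (m * k)) := by
        rw [mul_pow _ (k ^ (m * k)) 3, ← pow_mul k]
        ring
    _ ≤ T * (k.factorial ^ (m * m)) ^ 3 * k ^ (3 * (m * k)) := Nat.mul_le_mul_right _ h
    _ = _ := by ring

end BlockCount

/-- The quantitative lower bound for orders of the form `m ^ 2 * w + s`. -/
theorem maxTransversals_ge_of_odd {m w s : ℕ} (hm : Odd m) (hw : Odd w) (hs : 3 ≤ s)
    (hsk : s ≤ m * w) :
    ((m * w) ^ 2 - (s * (m * w) + 3 * w * (m * w))) ^ (m * (m * w)) *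
        (m * w).factorial ^ (3 * m) ≤
      maxTransversals (m * (m * w) + s) * (m * w) ^ (3 * (m * (m * w))) *
        w.factorial ^ (m * m) := by
  classical
  set k := m * w with hk
  have hkodd : Odd k := hm.mul hw
  have : NeZero k := ⟨hkodd.pos.ne'⟩
  have : NeZero m := ⟨hm.pos.ne'⟩
  obtain ⟨S, _, C, hS, hC, ⟨t, ht⟩⟩ := exists_isLatin_with_transversal hs
  obtain ⟨ι⟩ : Nonempty (S ↪ ZMod k) :=
    Function.Embedding.nonempty_of_card_le (by rw [hS, ZMod.card]; exact hsk)
  let K : ZMod k → ZMod k → ZMod k := fun x y => x + y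
  have hK : IsLatin K := isLatin_add _
  -- The union of the `s` disjoint transversals `y = x + ι i` of Z_k.
  let bad : Finset (ZMod k × ZMod k) :=
    Finset.univ.map ⟨fun q : S × ZMod k => (q.2, q.2 + ι q.1), by
      rintro ⟨i, x⟩ ⟨j, y⟩ h
      simp only [Prod.mk.injEq] at h
      obtain ⟨rfl, h⟩ := h
      rw [ι.injective (add_left_cancel h)]⟩
  have hbad : bad.card = s * k := by simp [bad, hS, ZMod.card]
  have hbadmem : ∀ i x, (x, x + ι i) ∈ bad := fun i x =>
    Finset.mem_map.2 ⟨(i, x), Finset.mem_univ _, rfl⟩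
  obtain ⟨α, β, γ, h⟩ := exists_blockSquare_card_mul_pow_ge (A := ZMod m) K
    (bad : Set (ZMod k × ZMod k)) (w := w) (by rw [ZMod.card, ZMod.card])
  rw [ZMod.card, ZMod.card] at h
  -- The graph `y = x + ι i`, placed in each diagonal block. As `m` and `k` are odd, doubling is
  -- injective on both factors, so this is a transversal of the block square.
  let τ : S → Equiv.Perm (ZMod m × ZMod k) := fun i =>
    { toFun := fun p => (p.1, β p.1 p.1 ((α p.1 p.1).symm p.2 + ι i))
      invFun := fun p => (p.1, α p.1 p.1 ((β p.1 p.1).symm p.2 - ι i))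
      left_inv := fun p => by simp
      right_inv := fun p => by simp }
  have hτ : ∀ i a x, τ i (a, x) = (a, β a a ((α a a).symm x + ι i)) := fun i a x => rfl
  set L := blockSquare K α β γ with hLdef
  have hL : IsLatin L := isLatin_blockSquare hK α β γ
  have hτL : ∀ i, Function.Injective fun p => L p (τ i p) := by
    rintro i ⟨a, x⟩ ⟨a', x'⟩ h
    simp only [hτ, hLdef, blockSquare, K, Prod.mk.injEq, Equiv.symm_apply_apply] at h
    obtain ⟨h1, h2⟩ := h
    obtain rfl : a = a' := ZMod.injective_add_self hm h1
    have h3 := (γ _ _).injective h2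
    rw [← add_assoc, ← add_assoc] at h3
    rw [(α a a).symm.injective (ZMod.injective_add_self hkodd (add_right_cancel h3))]
  have hτdisj : ∀ i j p, τ i p = τ j p → i = j := by
    rintro i j ⟨a, x⟩ h
    simp only [hτ, Prod.mk.injEq, true_and, EmbeddingLike.apply_eq_iff_eq, add_right_inj] at h
    exact h
  have hle : (partialTransversals L
      {c | ((α c.1.1 c.2.1).symm c.1.2, (β c.2.1 c.1.1).symm c.2.2) ∈ (bad : Set _)}
      (m * k)).card ≤ maxTransversals (m * k + s) := by
    refine le_trans (Finset.card_le_card ?_) ((card_partialTransversals_le_prolong (L := L)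
      (τ := τ) (a := m * k) ht).trans (card_partialTransversals_le_maxTransversals
        (isLatin_prolong hL hC hτL hτdisj) ?_))
    -- The counted transversals avoid the copies of `bad` in all blocks, hence the `τ i`, which use
    -- diagonal blocks only.
    · intro u hu
      obtain ⟨hu1, hu2, hu3⟩ := mem_partialTransversals.1 hu
      refine mem_partialTransversals.2 ⟨hu1, hu2, ?_⟩
      rintro ⟨⟨a, x⟩, q⟩ hp ⟨i, hi⟩
      refine hu3 _ hp ?_
      replace hi : τ i (a, x) = q := hi
      rw [hτ] at hi
      subst hi
      have := hbadmem i ((α a a).symm x)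
      simpa using this
    · simp [hS, ZMod.card]
  have hg := card_partialTransversals_mul_factorial_ge hK bad w
  rw [ZMod.card, hbad] at hg
  have hg' := Nat.pow_le_pow_left hg (m * m)
  rw [← pow_mul, mul_pow (partialTransversals K bad w).card, show w * (m * m) = m * k by rw [hk]; ring] at hg'
  calc _ ≤ ((partialTransversals K bad w).card ^ (m * m) * w.factorial ^ (m * m)) *
        k.factorial ^ (3 * m) := Nat.mul_le_mul_right _ hg'
    _ = ((partialTransversals K bad w).card ^ (m * m) * k.factorial ^ (3 * m)) *
        w.factorial ^ (m * m) := by ring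
    _ ≤ _ := Nat.mul_le_mul_right _ (h.trans (Nat.mul_le_mul_right _ hle))

/-! ### Asymptotics -/

theorem le_log_factorial (k : ℕ) : k * Real.log k - k ≤ Real.log k.factorial := by
  rcases Nat.eq_zero_or_pos k with rfl | hk
  · simp
  have hk' : (0 : ℝ) < k := by exact_mod_cast hk
  have h := Real.pow_div_factorial_le_exp (k : ℝ) hk'.le k
  have h1 := Real.log_le_log (by positivity) h
  rw [Real.log_exp, Real.log_div (by positivity) (by positivity), Real.log_pow] at h1
  linarith

theorem log_maxTransversals_ge_of_odd {m w s : ℕ} {η : ℝ} (hm : Odd m) (hw : Odd w) (hs : 3 ≤ s)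
    (hsw : s ≤ w) (hη : 0 < η) (hη1 : η ≤ 1) (h : (s : ℝ) / w + 3 / m ≤ 1 - η) {n : ℕ}
    (hn : m * (m * w) + s = n) :
    0 < maxTransversals n ∧
    n * Real.log n - 2 * n + n * Real.log η - (s + m ^ 2) * (Real.log n + 1) ≤
      Real.log (maxTransversals n) := by
  have hm0 : 0 < m := hm.pos
  have hw0 : 0 < w := hw.pos
  have hmR : (1 : ℝ) ≤ m := by exact_mod_cast hm0
  have hwR : (1 : ℝ) ≤ w := by exact_mod_cast hw0
  have hsk : s ≤ m * w := hsw.trans (Nat.le_mul_of_pos_left _ hm0)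
  have hmain := maxTransversals_ge_of_odd hm hw hs hsk
  rw [hn] at hmain
  have hkR : (0 : ℝ) < (m : ℝ) * w := by positivity
  -- Relative to `k²`, the excluded cells amount to `s/(m w) + 3/m`, at most `s/w + 3/m`.
  have hnum : ((m * w : ℝ) ^ 2) * η ≤
      (((m * w) ^ 2 - (s * (m * w) + 3 * w * (m * w)) : ℕ) : ℝ) := by
    have h1 : (((m * w) ^ 2 : ℕ) : ℝ) - ((s * (m * w) + 3 * w * (m * w) : ℕ) : ℝ) ≤
        (((m * w) ^ 2 - (s * (m * w) + 3 * w * (m * w)) : ℕ) : ℝ) := by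
      rw [sub_le_iff_le_add]
      exact_mod_cast le_tsub_add
    refine le_trans ?_ h1
    push_cast
    have h2 : (m * w : ℝ) ^ 2 * ((s : ℝ) / w + 3 / m) ≤ (m * w : ℝ) ^ 2 * (1 - η) :=
      mul_le_mul_of_nonneg_left h (by positivity)
    have h3 : (m * w : ℝ) ^ 2 * ((s : ℝ) / w + 3 / m) = s * (m * w) * m + 3 * w * (m * w) := by
      field_simp
    have h4 : (s : ℝ) * (m * w) ≤ s * (m * w) * m :=
      le_mul_of_one_le_right (by positivity) hmR
    linarith
  have hnumpos : (0 : ℝ) < ((m * w : ℝ) ^ 2) * η := by positivity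
  have hnat : 0 < (m * w) ^ 2 - (s * (m * w) + 3 * w * (m * w)) := by
    exact_mod_cast hnumpos.trans_le hnum
  have hT : 0 < maxTransversals n := by
    have hpos : 0 < ((m * w) ^ 2 - (s * (m * w) + 3 * w * (m * w))) ^ (m * (m * w)) *
        (m * w).factorial ^ (3 * m) := by positivity
    by_contra hT
    rw [Nat.eq_zero_of_not_pos hT, zero_mul, zero_mul] at hmain
    omega
  refine ⟨hT, ?_⟩
  have hTR : (0 : ℝ) < maxTransversals n := by exact_mod_cast hT
  have hlog : Real.log (((m * w : ℝ) ^ 2 * η) ^ (m * (m * w)) *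
        ((m * w).factorial : ℝ) ^ (3 * m)) ≤
      Real.log ((maxTransversals n : ℝ) * ((m * w : ℝ)) ^ (3 * (m * (m * w))) *
        (w.factorial : ℝ) ^ (m * m)) := by
    refine Real.log_le_log (by positivity) ?_
    calc _ ≤ ((((m * w) ^ 2 - (s * (m * w) + 3 * w * (m * w)) : ℕ) : ℝ)) ^ (m * (m * w)) *
        ((m * w).factorial : ℝ) ^ (3 * m) := by gcongr
      _ ≤ _ := by exact_mod_cast hmain
  rw [Real.log_mul (by positivity) (by positivity), Real.log_mul (by positivity) (by positivity),
    Real.log_mul (by positivity) (by positivity), Real.log_pow, Real.log_pow, Real.log_pow,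
    Real.log_pow, Real.log_mul (by positivity) (by positivity), Real.log_pow] at hlog
  have hf1 := le_log_factorial (m * w)
  have hf2 := log_factorial_le w
  have hlmw : Real.log ((m : ℝ) * w) = Real.log m + Real.log w :=
    Real.log_mul (by positivity) (by positivity)
  push_cast at hlog hf1
  rw [hlmw] at hlog hf1
  set M : ℝ := (m : ℝ)
  set W : ℝ := (w : ℝ)
  set N : ℝ := M * (M * W) with hN
  have hN0 : 0 < N := by positivity
  have hnR : (n : ℝ) = N + s := by rw [← hn]; push_cast; rfl
  have hs0 : (0 : ℝ) ≤ s := Nat.cast_nonneg s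
  have hlN : Real.log N = 2 * Real.log M + Real.log W := by
    rw [hN, Real.log_mul (by positivity) (by positivity), hlmw]
    ring
  have hb1 : 3 * M * (M * W * (Real.log M + Real.log W) - M * W) ≤
      3 * M * Real.log (m * w).factorial := mul_le_mul_of_nonneg_left hf1 (by positivity)
  have hb2 : M * M * Real.log w.factorial ≤
      M * M * (W * Real.log W - W + Real.log W + 1) := mul_le_mul_of_nonneg_left hf2 (by positivity)
  -- With `k = m w`, `2 log k - log w = log N`. The linear terms of `k!` and `w!` contribute `-3N`
  -- and `+N`, giving `-2N`.
  have key : N * Real.log N - 2 * N + N * Real.log η - M ^ 2 * (Real.log W + 1) ≤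
      Real.log (maxTransversals n) := by
    rw [hlN]
    simp only [hN] at hlog ⊢
    linarith
  have hn0 : (0 : ℝ) < n := by rw [hnR]; positivity
  -- Passing from the block order `N` to `n = N + s` costs only `s (log n + 1)`.
  have hNn : n * Real.log n - N * Real.log N ≤ s * Real.log n + s := by
    have h1 : Real.log n - Real.log N ≤ n / N - 1 := by
      rw [← Real.log_div hn0.ne' hN0.ne']
      exact Real.log_le_sub_one_of_pos (by positivity)
    have h2 := mul_le_mul_of_nonneg_left h1 hN0.le
    have h3 : N * (n / N - 1) = s := by
      rw [hnR]
      field_simp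
      ring
    rw [h3] at h2
    have h4 : (n : ℝ) * Real.log n = N * Real.log n + s * Real.log n := by rw [hnR]; ring
    linarith
  have hηn : n * Real.log η ≤ N * Real.log η := by
    have := mul_nonpos_of_nonneg_of_nonpos hs0 (Real.log_nonpos hη.le hη1)
    rw [hnR]
    linarith
  have hWn : W ≤ n := by
    rw [hnR, hN]
    have : W ≤ M * (M * W) := by
      have h1 : W ≤ M * W := le_mul_of_one_le_left (by positivity) hmR
      exact h1.trans (le_mul_of_one_le_left (by positivity) hmR)
    linarith
  have hWl : M ^ 2 * (Real.log W + 1) ≤ M ^ 2 * (Real.log n + 1) := by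
    have := Real.log_le_log (by positivity) hWn
    gcongr
  nlinarith

/-- Divide `n - 3` by `m²`. If the quotient is even, lower it by one and move the extra `m²` into
`s`; the reserved 3 guarantees that the corner has a transversal. -/
theorem exists_odd_decomposition {m n W : ℕ} (hm : 0 < m)
    (hn : m * (m * (W + 2)) + 3 ≤ n) :
    ∃ w s, Odd w ∧ W ≤ w ∧ 3 ≤ s ∧ s ≤ 2 * m ^ 2 + 3 ∧ m * (m * w) + s = n := by
  have hmm : 0 < m ^ 2 := by positivity
  have hdm := Nat.div_add_mod (n - 3) (m ^ 2)
  have hr := Nat.mod_lt (n - 3) hmm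
  have hqW : W + 2 ≤ (n - 3) / m ^ 2 := by
    rw [Nat.le_div_iff_mul_le hmm]
    have : (W + 2) * m ^ 2 = m * (m * (W + 2)) := by ring
    omega
  have hn3 : 3 ≤ n := by omega
  generalize (n - 3) / m ^ 2 = q at hdm hqW
  generalize (n - 3) % m ^ 2 = r at hdm hr
  have hqr : m ^ 2 * q + r + 3 = n := by omega
  rcases Nat.even_or_odd q with h | h
  · obtain ⟨p, rfl⟩ : ∃ p, q = p + 1 := ⟨q - 1, by omega⟩
    refine ⟨p, m ^ 2 + r + 3, ?_, by omega, by omega, by omega, ?_⟩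
    · obtain ⟨c, hc⟩ := h
      exact ⟨c - 1, by omega⟩
    · rw [← hqr]
      ring
  · refine ⟨q, r + 3, h, by omega, by omega, by omega, ?_⟩
    rw [← hqr]
    ring

theorem eventually_log_add_one_le {C c : ℝ} (hc : 0 < c) :
    ∀ᶠ n : ℕ in atTop, C * (Real.log n + 1) ≤ c * n := by
  have h : Tendsto (fun x : ℝ => C * (Real.log x + 1) / x) atTop (𝓝 0) := by
    have h1 := Real.isLittleO_log_id_atTop.tendsto_div_nhds_zero
    have h2 := (h1.add (tendsto_inv_atTop_zero (𝕜 := ℝ))).const_mul C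
    simp only [add_zero, mul_zero, id] at h2
    refine h2.congr fun x => ?_
    ring
  have h' := h.comp tendsto_natCast_atTop_atTop
  filter_upwards [h'.eventually (gt_mem_nhds hc), eventually_gt_atTop 0] with n hn hn0
  have hn0 : (0 : ℝ) < n := by exact_mod_cast hn0
  simp only [Function.comp_apply] at hn
  rw [div_lt_iff₀ hn0] at hn
  exact hn.le

theorem eventually_log_maxTransversals_ge {c : ℝ} (hc : 0 < c) :
    ∀ᶠ n : ℕ in atTop, 0 < maxTransversals n ∧
      n * Real.log n - 2 * n - c * n ≤ Real.log (maxTransversals n) := by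
  -- Half of `c` pays for `log η`, the other half for the logarithmic error. Likewise `1 - η` is
  -- split equally between `3/m` and `s/w`.
  set η := Real.exp (-(c / 2)) with hη
  have hη0 : 0 < η := Real.exp_pos _
  have hη1 : η < 1 := by rw [hη, Real.exp_lt_one_iff]; linarith
  obtain ⟨j, hj⟩ := exists_nat_gt (3 / ((1 - η) / 2))
  set m := 2 * j + 1 with hm
  have hm0 : (0 : ℝ) < m := by positivity
  have hjm : (j : ℝ) ≤ m := by rw [hm]; push_cast; linarith [Nat.cast_nonneg (α := ℝ) j]
  have h3m : 3 / (m : ℝ) ≤ (1 - η) / 2 := by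
    have : 0 < (1 - η) / 2 := by linarith
    rw [div_le_iff₀ hm0, ← div_le_iff₀' this]
    linarith
  obtain ⟨W₀, hW₀⟩ := exists_nat_gt (((2 * m ^ 2 + 3 : ℕ) : ℝ) / ((1 - η) / 2))
  set W := W₀ + (2 * m ^ 2 + 3) with hW
  have hlog := eventually_log_add_one_le (C := 3 * (m : ℝ) ^ 2 + 3) (half_pos hc)
  filter_upwards [hlog, eventually_ge_atTop (m * (m * (W + 2)) + 3)] with n hn hnW
  obtain ⟨w, s, hw, hWw, hs3, hs, hsum⟩ := exists_odd_decomposition (by omega) hnW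
  have hw0 : (0 : ℝ) < w := by exact_mod_cast hw.pos
  have hsw : (s : ℝ) / w ≤ (1 - η) / 2 := by
    have hpos : 0 < (1 - η) / 2 := by linarith
    rw [div_le_iff₀ hw0, ← div_le_iff₀' hpos]
    have h1 : (s : ℝ) / ((1 - η) / 2) ≤ ((2 * m ^ 2 + 3 : ℕ) : ℝ) / ((1 - η) / 2) := by
      gcongr
    have h2 : (W₀ : ℝ) ≤ w := by exact_mod_cast (by omega : W₀ ≤ w)
    linarith
  obtain ⟨hT, hle⟩ := log_maxTransversals_ge_of_odd (m := m) ⟨j, hm⟩ hw hs3 (by omega) hη0 hη1.le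
    (by linarith) hsum
  refine ⟨hT, le_trans ?_ hle⟩
  have hn1 : 1 ≤ n := by omega
  have hl0 : 0 ≤ Real.log n := Real.log_natCast_nonneg n
  have hs' : (s : ℝ) ≤ 2 * m ^ 2 + 3 := by exact_mod_cast hs
  have h1 : ((s : ℝ) + m ^ 2) * (Real.log n + 1) ≤ (3 * m ^ 2 + 3) * (Real.log n + 1) :=
    mul_le_mul_of_nonneg_right (by linarith) (by linarith)
  have h2 : Real.log η = -(c / 2) := by rw [hη, Real.log_exp]
  rw [h2]
  linarith

theorem eventually_log_maxTransversals_le {c : ℝ} (hc : 0 < c) :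
    ∀ᶠ n : ℕ in atTop, 0 < maxTransversals n →
      Real.log (maxTransversals n) ≤ n * Real.log n - 2 * n + c * n := by
  have h : Tendsto (fun x : ℝ => (5 + Real.log x + √x * (1 + Real.log x)) / x) atTop (𝓝 0) := by
    have h1 := Real.isLittleO_log_id_atTop.tendsto_div_nhds_zero
    have h2 := (tendsto_inv_atTop_zero (𝕜 := ℝ)).const_mul 5
    have h3 := (isLittleO_log_rpow_atTop (r := 1 / 2) (by norm_num)).tendsto_div_nhds_zero
    have h4 := (tendsto_rpow_neg_atTop (y := 1 / 2) (by norm_num))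
    have h5 := (h2.add h1).add (h4.add h3)
    simp only [mul_zero, add_zero] at h5
    refine h5.congr' ?_
    filter_upwards [eventually_gt_atTop 0] with x hx
    have hs : 0 < √x := Real.sqrt_pos.2 hx
    rw [Real.rpow_neg hx.le, ← Real.sqrt_eq_rpow]
    have hxx : x = √x * √x := (Real.mul_self_sqrt hx.le).symm
    have : √x * (1 + Real.log x) / x = (√x)⁻¹ + Real.log x / √x := by
      rw [div_eq_iff hx.ne']
      nth_rw 4 [hxx]
      field_simp
      rw [Real.sq_sqrt hx.le]
      ring
    rw [add_div, add_div, this, id, div_eq_mul_inv 5]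
  have h' := h.comp tendsto_natCast_atTop_atTop
  filter_upwards [h'.eventually (gt_mem_nhds hc), eventually_ge_atTop 3] with n hn hn3 hT
  have hn0 : (0 : ℝ) < n := by exact_mod_cast (by omega : 0 < n)
  simp only [Function.comp_apply] at hn
  rw [div_lt_iff₀ hn0] at hn
  linarith [log_maxTransversals_le hn3 hT]

/-- The final formulas are exact at every order, so the case `n = 0`, where the power is 1, must be
computed. -/
theorem maxTransversals_zero : maxTransversals 0 = 1 := by
  refine le_antisymm (Finset.sup_le fun L _ => ?_) ?_
  · refine (numTransversals_le_card_transversalFun L).trans ((Finset.card_le_univ _).trans ?_)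
    simp
  · have hL : IsLatin fun x _ : Fin 0 => x := ⟨fun x => x.elim0, fun x => x.elim0⟩
    refine le_trans ?_ (card_partialTransversals_le_maxTransversals hL (Fintype.card_fin 0))
    exact Finset.card_pos.2 ⟨∅, mem_partialTransversals.2
      ⟨by simp, ⟨by simp, by simp, by simp⟩, by simp⟩⟩

/-- The ratio of the `n`-th root of the maximum number of transversals to `n / e ^ 2`. -/
noncomputable def transversalRatio (n : ℕ) : ℝ :=
  (maxTransversals n : ℝ) ^ (n : ℝ)⁻¹ / ((n : ℝ) / Real.exp 1 ^ 2)

theorem transversalRatio_nonneg (n : ℕ) : 0 ≤ transversalRatio n := by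
  unfold transversalRatio
  positivity

theorem maxTransversals_eq_pow (n : ℕ) :
    (maxTransversals n : ℝ) = (transversalRatio n * ((n : ℝ) / Real.exp 1 ^ 2)) ^ n := by
  rcases Nat.eq_zero_or_pos n with rfl | hn
  · simp [maxTransversals_zero]
  have hn0 : (0 : ℝ) < n := by exact_mod_cast hn
  rw [transversalRatio, div_mul_cancel₀ _ (by positivity),
    Real.rpow_inv_natCast_pow (Nat.cast_nonneg _) hn.ne']

theorem tendsto_transversalRatio : Tendsto transversalRatio atTop (𝓝 1) := by
  -- The log of the ratio is `(log T(n) - (n log n - 2n)) / n`, which the two eventual bounds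
  -- squeeze to zero.
  have hlog : Tendsto (fun n => Real.log (transversalRatio n)) atTop (𝓝 0) := by
    rw [Metric.tendsto_atTop']
    intro c hc
    obtain ⟨N, hN⟩ := eventually_atTop.1 ((eventually_log_maxTransversals_ge (half_pos hc)).and
      (eventually_log_maxTransversals_le (half_pos hc)))
    refine ⟨N, fun n hn => ?_⟩
    obtain ⟨⟨hT, h1⟩, h2⟩ := hN n hn.le
    replace h2 := h2 hT
    have hn0 : (0 : ℝ) < n := by exact_mod_cast (by omega : 0 < n)
    have hT0 : (0 : ℝ) < maxTransversals n := by exact_mod_cast hT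
    have e : Real.log (transversalRatio n) =
        (Real.log (maxTransversals n) - (n * Real.log n - 2 * n)) / n := by
      rw [transversalRatio, Real.log_div (by positivity) (by positivity), Real.log_rpow hT0,
        Real.log_div (by positivity) (by positivity), Real.log_pow, Real.log_exp]
      field_simp
      push_cast
      ring
    rw [Real.dist_eq, sub_zero, e, abs_div, abs_of_pos hn0, div_lt_iff₀ hn0]
    have hcn : 0 < c * n := by positivity
    rw [abs_lt]
    constructor <;> linarith
  have hexp := (Real.continuous_exp.tendsto 0).comp hlog
  rw [Real.exp_zero] at hexp
  refine hexp.congr' ?_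
  filter_upwards [eventually_log_maxTransversals_ge one_pos, eventually_gt_atTop 0] with n hn hn0
  have hn0 : (0 : ℝ) < n := by exact_mod_cast hn0
  have hT0 : (0 : ℝ) < maxTransversals n := by exact_mod_cast hn.1
  exact Real.exp_log (by unfold transversalRatio; positivity)

theorem theorem2 :
    (∃ ε : ℕ → ℝ, Tendsto ε atTop (𝓝 0) ∧ (∀ n, 0 ≤ ε n ∧ ε n ≤ 1) ∧
      ∀ n : ℕ, ((1 - ε n) * ((n : ℝ) / Real.exp 1 ^ 2)) ^ n ≤ (maxTransversals n : ℝ)) ∧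
    (∃ δ : ℕ → ℝ, Tendsto δ atTop (𝓝 0) ∧ (∀ n, -1 ≤ δ n) ∧
      ∀ n : ℕ, (maxTransversals n : ℝ) = ((1 + δ n) * ((n : ℝ) / Real.exp 1 ^ 2)) ^ n) := by
  refine ⟨⟨fun n => max 0 (1 - transversalRatio n), ?_, fun n => ⟨le_max_left _ _, ?_⟩,
    fun n => ?_⟩, fun n => transversalRatio n - 1, ?_, fun n => ?_, fun n => ?_⟩
  · have h := (tendsto_const_nhds (x := (0 : ℝ))).max
      ((tendsto_const_nhds (x := (1 : ℝ))).sub tendsto_transversalRatio)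
    simpa using h
  · exact max_le zero_le_one (by linarith [transversalRatio_nonneg n])
  · rw [maxTransversals_eq_pow n]
    have h1 : max 0 (1 - transversalRatio n) ≤ 1 :=
      max_le zero_le_one (by linarith [transversalRatio_nonneg n])
    have h2 := le_max_right 0 (1 - transversalRatio n)
    refine pow_le_pow_left₀ (mul_nonneg (by linarith) (by positivity)) ?_ n
    exact mul_le_mul_of_nonneg_right (by linarith) (by positivity)
  · simpa using tendsto_transversalRatio.sub_const 1
  · linarith [transversalRatio_nonneg n]
  · rw [add_sub_cancel]
    exact maxTransversals_eq_pow n
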